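/- A regular expression over the alphabet $\Sigma=\{0,1,2,\dots\}$ is regarded as a finite rooted tree whose leaves carry letters and whose inner nodes carry one of the operators $\circ$ (concatenation), $|$ (or), $+$ (Kleene plus), $*$ (Kleene star); nodes labelled $+$ or $*$ have exactly one child, nodes labelled $\circ$ or $|$ have one or more children. Its language is defined as usual, with $\mathcal L(\mathcal A^+)=\{w_1\cdots w_k : k\ge 1,\ w_i\in\mathcal L(\mathcal A)\}$ and $\mathcal L(\mathcal A^*)=\mathcal L(\mathcal A^+)\cup\{\epsilon\}$, and its size is the number of leaves. It is homogeneous of type $t_1\cdots t_d$ (with $t_i\neq t_{i+1}$) if every inner node at level $i$ is labelled $t_i$ and the largest number of inner nodes on a root-to-leaf path is $d$ (leaves may occur at any level). The $(t,u)$-intersection testing problem asks, given homogeneous regular expressions $\mathcal A$ of type $t$ and size $m$ and $\mathcal B$ of type $u$ and size $n$, whether $\mathcal L(\mathcal A)\cap\mathcal L(\mathcal B)\ne\emptyset$. The letters are integers from an alphabet of polynomial size, $\{0,\dots,(m+n)^a-1\}$ for a fixed integer $a\ge 1$. The computation model is the deterministic word RAM with unit-cost operations on words of logarithmic length ($O(\log(m+n))$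 bits for intersection testing; $O(N+\log L)$ bits for $k$-SAT with $N$ variables and input length $L$). The Strong Exponential Time Hypothesis (SETH) states that for every $\varepsilon>0$ there is a $k$ such that $k$-SAT on formulas with $N$ variables and input length $L$ cannot be solved in time $O(2^{(1-\varepsilon)N}\cdot\mathrm{poly}(L))$. **Corollary.** Assume SETH. Then for every $t\in\{\circ *,\ \circ |,\ \circ +,\ |\circ,\ +\circ,\ *\circ\}$, every integer $a\ge 1$ and every $\alpha>0$, the $(\circ *,t)$-intersection testing problem over the alphabet $\{0,\dots,(m+n)^a-1\}$ cannot be solved in time $O((mn)^{1-\alpha}+m+n)$; in particular, it cannot be solved in time $O((mn)^{1-\alpha})$. -/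

import Mathlib

/-! ## Regular expressions as trees -/

/-- The operators: concatenation, OR, Kleene plus and Kleene star. -/
inductive RegOp where
  | cat
  | alt
  | plus
  | star
  deriving DecidableEq

/-- Regular expressions over the integer alphabet `ℕ` in their tree representation: leaves carry
letters, concatenation and OR nodes have a list of children, plus and star nodes have one child. -/
inductive Regexp where
  | letter (a : ℕ)
  | cat (es : List Regexp)
  | alt (es : List Regexp)
  | plus (e : Regexp)
  | star (e : Regexp)

namespace Regexp

/-- The language of a regular expression; product, sum and `∗` are concatenation, union and
Kleene closure of languages. -/
def lang : Regexp → Language ℕ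
  | letter a => {[a]}
  | cat es => (es.map fun e => lang e).prod
  | alt es => (es.map fun e => lang e).sum
  | plus e => lang e * KStar.kstar (lang e)
  | star e => KStar.kstar (lang e)

/-- The size: the number of leaves of the tree. -/
def size : Regexp → ℕ
  | letter _ => 1
  | cat es => (es.map fun e => size e).sum
  | alt es => (es.map fun e => size e).sum
  | plus e => size e
  | star e => size e

/-- The largest number of inner nodes on a path from the root to a leaf. -/
def depth : Regexp → ℕ
  | letter _ => 0
  | cat es => (es.map fun e => depth e).foldr max 0 + 1
  | alt es => (es.map fun e => depth e).foldr max 0 + 1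
  | plus e => depth e + 1
  | star e => depth e + 1

/-- The letters occurring in a regular expression, from left to right. -/
def letters : Regexp → List ℕ
  | letter a => [a]
  | cat es => (es.map fun e => letters e).flatten
  | alt es => (es.map fun e => letters e).flatten
  | plus e => letters e
  | star e => letters e

/-- `HasShape [t₁, …, t_d] e`: every inner node of `e` at level `i` is labelled `t_i` (there are
none below level `d`) and has at least one child. Leaves may occur at any level. -/
def HasShape : List RegOp → Regexp → Prop
  | _, letter _ => True
  | RegOp.cat :: t, cat es => es ≠ [] ∧ ∀ e ∈ es, HasShape t e
  | RegOp.alt :: t, alt es => es ≠ [] ∧ ∀ e ∈ es, HasShape t e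
  | RegOp.plus :: t, plus e => HasShape t e
  | RegOp.star :: t, star e => HasShape t e
  | _, _ => False

/-- `e` is a homogeneous regular expression of type `t` (and depth `t.length`). -/
def IsHomogeneous (t : List RegOp) (e : Regexp) : Prop :=
  t.IsChain (· ≠ ·) ∧ HasShape t e ∧ depth e = t.length

/-- The representation of a regular expression as a sequence of integers: the tree in preorder,
each node given by an integer for its kind, followed by the letter for a leaf and by the number of
children for concatenation and OR nodes. -/
def encode : Regexp → List ℕ
  | letter a => [0, a]
  | cat es => 1 :: es.length :: (es.map fun e => encode e).flatten
  | alt es => 2 :: es.length :: (es.map fun e => encode e).flatten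
  | plus e => 3 :: encode e
  | star e => 4 :: encode e

end Regexp

/-! ## The word RAM -/

namespace WordRAM

/-- The arithmetic, comparison and bitwise operations of the machine. -/
inductive BinOp where
  | add | sub | mul | div | mod | lt | eq | and | or | xor | shl | shr

/-- The value of an operation (subtraction is truncated at `0`, division by `0` gives `0`,
comparisons give `0` or `1`). -/
def BinOp.eval : BinOp → ℕ → ℕ → ℕ
  | add, x, y => x + y
  | sub, x, y => x - y
  | mul, x, y => x * y
  | div, x, y => x / y
  | mod, x, y => x % y
  | lt, x, y => if x < y then 1 else 0
  | eq, x, y => if x = y then 1 else 0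
  | and, x, y => x &&& y
  | or, x, y => x ||| y
  | xor, x, y => x ^^^ y
  | shl, x, y => x <<< y
  | shr, x, y => x >>> y

/-- Programs of a random access machine with registers and a memory, with structured control flow.
A program mentions only finitely many registers. -/
inductive Prog where
  /-- do nothing -/
  | skip
  /-- `reg r := k` -/
  | const (r k : ℕ)
  /-- `reg r := o (reg x) (reg y)` -/
  | op (o : BinOp) (r x y : ℕ)
  /-- `reg r := mem (reg x)` -/
  | load (r x : ℕ)
  /-- `mem (reg x) := reg y` -/
  | store (x y : ℕ)
  /-- first `p`, then `q` -/
  | seq (p q : Prog)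
  /-- `p` if `reg r ≠ 0`, otherwise `q` -/
  | ite (r : ℕ) (p q : Prog)
  /-- repeat `p` as long as `reg r ≠ 0` -/
  | loop (r : ℕ) (p : Prog)

/-- The contents of the registers and of the memory cells. -/
structure State where
  reg : ℕ → ℕ
  mem : ℕ → ℕ

/-- Write `v` into register `r`. -/
def State.setReg (s : State) (r v : ℕ) : State := ⟨Function.update s.reg r v, s.mem⟩

/-- Write `v` into memory cell `i`. -/
def State.setMem (s : State) (i v : ℕ) : State := ⟨s.reg, Function.update s.mem i v⟩

/-- `Exec W p s k s'`: started in state `s`, the program `p` halts in state `s'` after exactly `k`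
elementary steps, and every integer that it computes is smaller than `W`, that is, fits into a
machine word of `log₂ W` bits. A program that computes a larger integer has no execution. -/
inductive Exec (W : ℕ) : Prog → State → ℕ → State → Prop
  | skip (s : State) : Exec W Prog.skip s 1 s
  | const (s : State) (r k : ℕ) : k < W → Exec W (Prog.const r k) s 1 (s.setReg r k)
  | op (s : State) (o : BinOp) (r x y : ℕ) : o.eval (s.reg x) (s.reg y) < W →
      Exec W (Prog.op o r x y) s 1 (s.setReg r (o.eval (s.reg x) (s.reg y)))
  | load (s : State) (r x : ℕ) : Exec W (Prog.load r x) s 1 (s.setReg r (s.mem (s.reg x)))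
  | store (s : State) (x y : ℕ) : Exec W (Prog.store x y) s 1 (s.setMem (s.reg x) (s.reg y))
  | seq {p q : Prog} {s₁ s₂ s₃ : State} {k l : ℕ} : Exec W p s₁ k s₂ → Exec W q s₂ l s₃ →
      Exec W (Prog.seq p q) s₁ (k + l) s₃
  | ite_pos {r : ℕ} {p q : Prog} {s s' : State} {k : ℕ} : s.reg r ≠ 0 → Exec W p s k s' →
      Exec W (Prog.ite r p q) s (k + 1) s'
  | ite_neg {r : ℕ} {p q : Prog} {s s' : State} {k : ℕ} : s.reg r = 0 → Exec W q s k s' →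
      Exec W (Prog.ite r p q) s (k + 1) s'
  | loop_stop {r : ℕ} {p : Prog} {s : State} : s.reg r = 0 → Exec W (Prog.loop r p) s 1 s
  | loop_step {r : ℕ} {p : Prog} {s₁ s₂ s₃ : State} {k l : ℕ} : s₁.reg r ≠ 0 →
      Exec W p s₁ k s₂ → Exec W (Prog.loop r p) s₂ l s₃ →
      Exec W (Prog.loop r p) s₁ (k + l + 1) s₃

/-- The initial state on an input: the input is in memory cells `0, 1, 2, …`, its length is in
register `0`, and everything else is `0`. -/
def inputState (x : List ℕ) : State :=
  ⟨fun r => if r = 0 then x.length else 0, fun i => x.getD i 0⟩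

/-- On input `x` and with words bounded by `W` (into which the input fits), the program `p` halts
after at most `T` steps and answers correctly the question whether `answer` holds; the answer is
yes if register `0` is nonzero at the end. -/
def DecidesWithin (p : Prog) (W : ℕ) (x : List ℕ) (answer : Prop) (T : ℝ) : Prop :=
  x.length < W ∧ (∀ v ∈ x, v < W) ∧
    ∃ (k : ℕ) (s : State), Exec W p (inputState x) k s ∧ (k : ℝ) ≤ T ∧ (s.reg 0 ≠ 0 ↔ answer)

end WordRAM

/-! ## The intersection testing problem -/

/-- The `(t, u)`-intersection testing problem over the integer alphabet `{0, …, (m+n)^a - 1}`, `m`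
and `n` being the sizes of the two given expressions, can be solved in time `O(T m n)` on a word RAM
with words of `O(log (m+n))` bits. -/
def IntersectionTestingSolvable (t u : List RegOp) (a : ℕ) (T : ℕ → ℕ → ℝ) : Prop :=
  ∃ (p : WordRAM.Prog) (c C : ℕ), ∀ A B : Regexp,
    A.IsHomogeneous t → B.IsHomogeneous u →
    (∀ x ∈ A.letters ++ B.letters, x < (A.size + B.size) ^ a) →
    WordRAM.DecidesWithin p ((A.size + B.size) ^ c) (A.encode ++ B.encode)
      (∃ w : List ℕ, w ∈ A.lang ∧ w ∈ B.lang) (C * T A.size B.size)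

/-! ## The Strong Exponential Time Hypothesis -/

/-- Formulas in conjunctive normal form with variables `x_i`, `i : Fin n`: lists of clauses, which
are lists of literals, `(i, true)` standing for `x_i` and `(i, false)` for its negation. -/
abbrev CNFFormula (n : ℕ) := List (List (Fin n × Bool))

namespace CNFFormula

/-- Every clause has at most `k` literals. -/
def IsKCNF {n : ℕ} (k : ℕ) (φ : CNFFormula n) : Prop := ∀ cl ∈ φ, cl.length ≤ k

/-- Some assignment makes a literal true in every clause. -/
def Satisfiable {n : ℕ} (φ : CNFFormula n) : Prop :=
  ∃ v : Fin n → Bool, ∀ cl ∈ φ, ∃ l ∈ cl, v l.1 = l.2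

/-- The representation of a formula as a sequence of integers: the number of variables, the number
of clauses, and then for every clause its number of literals and its literals. -/
def encode {n : ℕ} (φ : CNFFormula n) : List ℕ :=
  n :: List.length φ ::
    (φ.map fun cl => cl.length :: cl.map fun l => 2 * (l.1 : ℕ) + l.2.toNat).flatten

end CNFFormula

/-- `k`-SAT can be solved in time `O(2^(δ n) poly(L))`, `n` being the number of variables and `L` the
length of the given formula, on a word RAM with words of `O(n + log L)` bits. -/
def KSatSolvable (k : ℕ) (δ : ℝ) : Prop :=
  ∃ (p : WordRAM.Prog) (c C : ℕ), ∀ (n : ℕ) (φ : CNFFormula n), φ.IsKCNF k →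
    WordRAM.DecidesWithin p ((2 ^ n + φ.encode.length) ^ c) φ.encode φ.Satisfiable
      (C * (2 : ℝ) ^ (δ * n) * (φ.encode.length : ℝ) ^ C)

/-- The Strong Exponential Time Hypothesis: for every `ε > 0` there is a `k` such that `k`-SAT cannot
be solved in time `O(2^((1-ε) n) poly(L))`. -/
def SETH : Prop := ∀ ε : ℝ, 0 < ε → ∃ k : ℕ, ¬ KSatSolvable k (1 - ε)

/-! A fast intersection test would solve `k`-SAT too fast for every `k`. Split the `n` variables
into the lower `h = ⌈n/2⌉` ones and the rest, and let `M = 2 ^ h`. A formula is satisfiable iff some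
lower assignment `i` and some upper assignment `j` have the property that `i` satisfies every clause
that `j` leaves open. This search over pairs of 0-1 vectors becomes one membership question: does a
word (the text, listing upper assignments) belong to the language of an expression of type `∘*` (the
pattern, listing lower assignments)?

A pattern coordinate `v` becomes `0* v* 2` and a text coordinate `b` becomes `b 2`; they match iff
`b = 0` or `b = v` (`compatible_of_mem`). The letter 3 opens every text vector. A pattern block
compares its vector with one text vector and then skips one or two further ones: skipped contents
are absorbed by long products of `0* 1* 2*`, and an optional extra 3 comes from `3*`, which cannot
be used twice because the text has no factor `33`. Neighbouring blocks therefore sit at text indices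
that differ by 2 or 3 (`text_mem_pattern_iff`).

All blocks must match, although only one pair `(i, j)` need be good. So the text has, for each `J`,
a genuine vector at index `3J + 1` and dummies, zero on all clauses, at `3J` and `3J + 2`. Two extra
coordinates force block `0` onto residue 2 and block `M + 1` onto residue 0 modulo 3. Steps of 2 or
3 lead from residue 2 only to 2 or 1, so some block meets a genuine vector. Conversely a good pair
allows residue 2 before the good block, 1 at it and 0 after it (`satisfiable_iff_aligned`).

The second expression must describe the text alone. Each of the six types can do so up to words that
the pattern cannot produce, thanks to a final marker 4 (`exists_isWordExpr`, `eq_of_mem_pattern`).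

Both sizes are `O(M L)` for input length `L`, so their product is `O(2^n L^2)`, and with `ε = min α
(1/2)` the assumed algorithm runs in time `2^((1-ε)n) poly(L)`; the linear terms are only `O(2^(n/2)
L)`. On the machine, a program appends both codes to its input and then runs a copy of the assumed
algorithm with shifted registers and memory (`Exec.relocate`, `decides_reduction`). -/

/-- The concatenation `f (n - 1) ++ ⋯ ++ f 0`. -/
def down {α : Type*} (f : ℕ → List α) : ℕ → List α
  | 0 => []
  | n + 1 => f n ++ down f n

namespace WordRAM

/-! ### Relocation of programs -/

/-- The program `p` with all registers shifted by `64` and with its memory shifted by the contents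
of register `1`; register `2` holds intermediate addresses. -/
def Prog.relocate : Prog → Prog
  | skip => skip
  | const r k => const (r + 64) k
  | op o r x y => op o (r + 64) (x + 64) (y + 64)
  | load r x => seq (op BinOp.add 2 (x + 64) 1) (load (r + 64) 2)
  | store x y => seq (op BinOp.add 2 (x + 64) 1) (store 2 (y + 64))
  | seq p q => seq p.relocate q.relocate
  | ite r p q => ite (r + 64) p.relocate q.relocate
  | loop r p => loop (r + 64) p.relocate

/-- All words of the state are smaller than `W`. -/
def State.Bounded (W : ℕ) (s : State) : Prop := (∀ r, s.reg r < W) ∧ ∀ i, s.mem i < W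

/-- The state `t` holds the state `s` with registers shifted by `64` and memory shifted by `off`. -/
structure Simulates (off : ℕ) (s t : State) : Prop where
  reg : ∀ r, t.reg (r + 64) = s.reg r
  mem : ∀ i, t.mem (i + off) = s.mem i
  off : t.reg 1 = off

theorem State.Bounded.setReg {W : ℕ} {s : State} (h : s.Bounded W) {r v : ℕ} (hv : v < W) :
    (s.setReg r v).Bounded W := by
  refine ⟨fun r' => ?_, h.2⟩
  simp only [State.setReg, Function.update_apply]
  split_ifs
  exacts [hv, h.1 _]

theorem State.Bounded.setMem {W : ℕ} {s : State} (h : s.Bounded W) {i v : ℕ} (hv : v < W) :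
    (s.setMem i v).Bounded W := by
  refine ⟨h.1, fun r' => ?_⟩
  simp only [State.setMem, Function.update_apply]
  split_ifs
  exacts [hv, h.2 _]

theorem Simulates.setReg {off : ℕ} {s t : State} (h : Simulates off s t) (r v : ℕ) :
    Simulates off (s.setReg r v) (t.setReg (r + 64) v) := by
  refine ⟨fun r' => ?_, h.mem, ?_⟩
  · simp [State.setReg, Function.update_apply, h.reg]
  · simp [State.setReg, h.off]

theorem Simulates.setTemp {off : ℕ} {s t : State} (h : Simulates off s t) (v : ℕ) :
    Simulates off s (t.setReg 2 v) := by
  refine ⟨fun r' => ?_, h.mem, ?_⟩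
  · simp [State.setReg, h.reg]
  · simp [State.setReg, h.off]

theorem Simulates.setMem {off : ℕ} {s t : State} (h : Simulates off s t) (i v : ℕ) :
    Simulates off (s.setMem i v) (t.setMem (i + off) v) := by
  refine ⟨h.reg, fun j => ?_, h.off⟩
  simp [State.setMem, Function.update_apply, h.mem]

/-- Only loads and stores become longer, by one address computation each, hence the factor 2. Since
every register of the simulated machine stays below `W`, a shifted address stays below `W + off`;
this is why boundedness is carried through the induction. -/
theorem Exec.relocate {W off : ℕ} {p : Prog} {s s' : State} {k : ℕ} (h : Exec W p s k s') :
    ∀ t, s.Bounded W → Simulates off s t → s'.Bounded W ∧ ∃ k' t', k' ≤ 2 * k ∧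
      Exec (W + off) p.relocate t k' t' ∧ Simulates off s' t' := by
  have weak : ∀ {v : ℕ}, v < W → v < W + off := fun h => by omega
  induction h with
  | skip s => exact fun t hb hs => ⟨hb, 1, t, by omega, Exec.skip t, hs⟩
  | const s r k hk =>
    exact fun t hb hs => ⟨hb.setReg hk, 1, _, by omega, Exec.const t _ _ (weak hk), hs.setReg _ _⟩
  | op s o r x y hv =>
    intro t hb hs
    have e : o.eval (t.reg (x + 64)) (t.reg (y + 64)) = o.eval (s.reg x) (s.reg y) := by
      rw [hs.reg, hs.reg]
    refine ⟨hb.setReg hv, 1, _, by omega, Exec.op t o _ _ _ (by rw [e]; exact weak hv), ?_⟩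
    rw [e]
    exact hs.setReg _ _
  | load s r x =>
    intro t hb hs
    have e : BinOp.add.eval (t.reg (x + 64)) (t.reg 1) = s.reg x + off := by
      rw [hs.reg, hs.off]; rfl
    have hx := hb.1 x
    refine ⟨hb.setReg (hb.2 _), 1 + 1, _, by omega,
      Exec.seq (Exec.op t BinOp.add 2 (x + 64) 1 (by rw [e]; omega)) (Exec.load _ _ _), ?_⟩
    rw [e]
    have hs' := (hs.setTemp (s.reg x + off)).setReg r (s.mem (s.reg x))
    convert hs' using 2
    simp [State.setReg, hs.mem]
  | store s x y =>
    intro t hb hs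
    have e : BinOp.add.eval (t.reg (x + 64)) (t.reg 1) = s.reg x + off := by
      rw [hs.reg, hs.off]; rfl
    have hx := hb.1 x
    refine ⟨hb.setMem (hb.1 _), 1 + 1, _, by omega,
      Exec.seq (Exec.op t BinOp.add 2 (x + 64) 1 (by rw [e]; omega)) (Exec.store _ _ _), ?_⟩
    rw [e]
    have hs' := (hs.setTemp (s.reg x + off)).setMem (s.reg x) (s.reg y)
    convert hs' using 2
    · simp [State.setReg]
    · simp [State.setReg, hs.reg]
  | seq h1 h2 ih1 ih2 =>
    intro t hb hs
    obtain ⟨hb', k', t', hk, he, hs'⟩ := ih1 t hb hs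
    obtain ⟨hb'', l', t'', hl, he', hs''⟩ := ih2 t' hb' hs'
    exact ⟨hb'', k' + l', t'', by omega, Exec.seq he he', hs''⟩
  | ite_pos hr _ ih =>
    intro t hb hs
    obtain ⟨hb', k', t', hk, he, hs'⟩ := ih t hb hs
    exact ⟨hb', k' + 1, t', by omega, Exec.ite_pos (by rwa [hs.reg]) he, hs'⟩
  | ite_neg hr _ ih =>
    intro t hb hs
    obtain ⟨hb', k', t', hk, he, hs'⟩ := ih t hb hs
    exact ⟨hb', k' + 1, t', by omega, Exec.ite_neg (by rwa [hs.reg]) he, hs'⟩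
  | loop_stop hr =>
    intro t hb hs
    exact ⟨hb, 1, t, by omega, Exec.loop_stop (by rwa [hs.reg]), hs⟩
  | loop_step hr h1 h2 ih1 ih2 =>
    intro t hb hs
    obtain ⟨hb', k', t', hk, he, hs'⟩ := ih1 t hb hs
    obtain ⟨hb'', l', t'', hl, he', hs''⟩ := ih2 t' hb' hs'
    exact ⟨hb'', k' + l' + 1, t'', by omega, Exec.loop_step (by rwa [hs.reg]) he he', hs''⟩

theorem Exec.mono {W W' : ℕ} (hW : W ≤ W') {p : Prog} {s s' : State} {k : ℕ}
    (h : Exec W p s k s') : Exec W' p s k s' := by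
  induction h with
  | skip s => exact Exec.skip s
  | const s r k hk => exact Exec.const s r k (hk.trans_le hW)
  | op s o r x y hv => exact Exec.op s o r x y (hv.trans_le hW)
  | load s r x => exact Exec.load s r x
  | store s x y => exact Exec.store s x y
  | seq _ _ ih1 ih2 => exact Exec.seq ih1 ih2
  | ite_pos hr _ ih => exact Exec.ite_pos hr ih
  | ite_neg hr _ ih => exact Exec.ite_neg hr ih
  | loop_stop hr => exact Exec.loop_stop hr
  | loop_step hr _ _ ih1 ih2 => exact Exec.loop_step hr ih1 ih2

/-! ### Programs that append to their input -/

/-- The memory holds the input `x` followed by the list `out`, register `0` points behind them, the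
registers `1, 2, …` hold the values `Γ`, and the registers from `64` on are `0`. -/
structure Holds (x Γ out : List ℕ) (s : State) : Prop where
  mem : ∀ i, s.mem i = (x ++ out).getD i 0
  ptr : s.reg 0 = x.length + out.length
  env : ∀ (i v : ℕ), Γ[i]? = some v → s.reg (i + 1) = v
  high : ∀ r, 64 ≤ r → s.reg r = 0

/-- Within `T` steps, `p` appends `f` to the output and changes the registers from `Γ` to `Γ'`. -/
def Runs (W : ℕ) (x Γ : List ℕ) (p : Prog) (T : ℕ) (Γ' f : List ℕ) : Prop :=
  ∀ (s : State) (out : List ℕ), x.length + out.length + f.length < W → Holds x Γ out s →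
    ∃ k s', k ≤ T ∧ Exec W p s k s' ∧ Holds x Γ' (out ++ f) s'

namespace Runs

variable {W : ℕ} {x Γ Γ' Γ'' : List ℕ} {p q : Prog} {T T' : ℕ} {f g : List ℕ}

theorem seq (h : Runs W x Γ p T Γ' f) (h' : Runs W x Γ' q T' Γ'' g) :
    Runs W x Γ (Prog.seq p q) (T + T') Γ'' (f ++ g) := by
  intro s out hl hs
  rw [List.length_append] at hl
  obtain ⟨k, s', hk, he, hs'⟩ := h s out (by omega) hs
  obtain ⟨k', s'', hk', he', hs''⟩ := h' s' (out ++ f) (by rw [List.length_append]; omega) hs'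
  exact ⟨k + k', s'', by omega, Exec.seq he he', by rwa [← List.append_assoc]⟩

theorem mono (h : Runs W x Γ p T Γ' f) (hT : T ≤ T') : Runs W x Γ p T' Γ' f := by
  intro s out hl hs
  obtain ⟨k, s', hk, he, hs'⟩ := h s out hl hs
  exact ⟨k, s', hk.trans hT, he, hs'⟩

/-- `Γ` records only what is known about the registers, so local registers at its end can be
forgotten and reused later. -/
theorem weaken (h : Runs W x Γ p T (Γ' ++ Γ'') f) : Runs W x Γ p T Γ' f := by
  intro s out hl hs
  obtain ⟨k, s', hk, he, hs'⟩ := h s out hl hs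
  refine ⟨k, s', hk, he, hs'.mem, hs'.ptr, fun i v hi => hs'.env i v ?_, hs'.high⟩
  rw [List.getElem?_append_left (List.getElem?_eq_some_iff.1 hi).1, hi]

theorem skip : Runs W x Γ Prog.skip 1 Γ [] := fun s out _ hs =>
  ⟨1, s, le_rfl, Exec.skip s, by rwa [List.append_nil]⟩

/-- Entry `i` of `Γ` lives in register `i + 1`, register `0` being the output pointer. The bound 63
keeps the written register below 64, where the zeroed registers of the relocated program begin. -/
theorem _root_.WordRAM.Holds.setNew {out : List ℕ} {s : State} (hs : Holds x Γ out s)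
    (hΓ : Γ.length < 63) (v : ℕ) : Holds x (Γ ++ [v]) out (s.setReg (Γ.length + 1) v) := by
  refine ⟨hs.mem, ?_, ?_, ?_⟩
  · simp [State.setReg, hs.ptr]
  · intro i w hi
    rcases lt_trichotomy i Γ.length with h | h | h
    · rw [List.getElem?_append_left h] at hi
      simp only [State.setReg, Function.update_apply]
      rw [if_neg (by omega), hs.env i w hi]
    · subst h
      simp only [List.getElem?_concat_length, Option.some.injEq] at hi
      simp [State.setReg, hi]
    · rw [List.getElem?_eq_none (by simp; omega)] at hi
      simp at hi
  · intro r hr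
    simp only [State.setReg, Function.update_apply]
    rw [if_neg (by omega), hs.high r hr]

theorem _root_.WordRAM.Holds.setOld {out : List ℕ} {s : State} (hs : Holds x Γ out s)
    (j v : ℕ) (hj : j < 63) : Holds x (Γ.set j v) out (s.setReg (j + 1) v) := by
  refine ⟨hs.mem, ?_, ?_, ?_⟩
  · simp [State.setReg, hs.ptr]
  · intro i w hi
    simp only [State.setReg, Function.update_apply]
    rw [List.getElem?_set] at hi
    split_ifs at hi with h1 h2
    · subst h1
      simpa using hi
    · rw [if_neg (by omega), hs.env i w hi]
  · intro r hr
    simp only [State.setReg, Function.update_apply]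
    rw [if_neg (by omega), hs.high r hr]

theorem const (k : ℕ) (hk : k < W) (r : ℕ) (hr : r = Γ.length + 1) (hΓ : Γ.length < 63) :
    Runs W x Γ (Prog.const r k) 1 (Γ ++ [k]) [] := by
  subst hr
  intro s out _ hs
  exact ⟨1, _, le_rfl, Exec.const s _ _ hk, by rw [List.append_nil]; exact hs.setNew hΓ k⟩

theorem op (o : BinOp) (r i j : ℕ) {a b : ℕ} (hi : Γ[i]? = some a) (hj : Γ[j]? = some b)
    (hr : r = Γ.length + 1) (hΓ : Γ.length < 63) (hW : o.eval a b < W) :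
    Runs W x Γ (Prog.op o r (i + 1) (j + 1)) 1 (Γ ++ [o.eval a b]) [] := by
  subst hr
  intro s out _ hs
  rw [← hs.env i a hi, ← hs.env j b hj] at hW ⊢
  exact ⟨1, _, le_rfl, Exec.op s o _ _ _ hW, by rw [List.append_nil]; exact hs.setNew hΓ _⟩

theorem update (o : BinOp) (r i j : ℕ) {a b : ℕ} (hi : Γ[i]? = some a) (hj : Γ[j]? = some b)
    (hr : r < 63) (hW : o.eval a b < W) :
    Runs W x Γ (Prog.op o (r + 1) (i + 1) (j + 1)) 1 (Γ.set r (o.eval a b)) [] := by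
  intro s out _ hs
  rw [← hs.env i a hi, ← hs.env j b hj] at hW ⊢
  exact ⟨1, _, le_rfl, Exec.op s o _ _ _ hW, by rw [List.append_nil]; exact hs.setOld _ _ hr⟩

theorem load (r j : ℕ) {a v : ℕ} (hj : Γ[j]? = some a) (hv : x[a]? = some v)
    (hr : r = Γ.length + 1) (hΓ : Γ.length < 63) :
    Runs W x Γ (Prog.load r (j + 1)) 1 (Γ ++ [v]) [] := by
  subst hr
  intro s out _ hs
  have e : s.mem (s.reg (j + 1)) = v := by
    rw [hs.env j a hj, hs.mem, List.getD_eq_getElem?_getD,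
      List.getElem?_append_left (List.getElem?_eq_some_iff.1 hv).1, hv]
    rfl
  refine ⟨1, _, le_rfl, Exec.load s _ _, ?_⟩
  rw [List.append_nil, e]
  exact hs.setNew hΓ _

/-- Append the contents of a register to the output; register `2` holds the number `1`. -/
def _root_.WordRAM.Prog.emit (r : ℕ) : Prog :=
  Prog.seq (Prog.store 0 r) (Prog.op BinOp.add 0 0 2)

theorem emit (j : ℕ) {v : ℕ} (h1 : Γ[1]? = some 1) (hj : Γ[j]? = some v) :
    Runs W x Γ (Prog.emit (j + 1)) 2 Γ [v] := by
  intro s out hl hs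
  have e1 : s.reg 2 = 1 := hs.env 1 1 h1
  have ej := hs.env j v hj
  simp only [List.length_singleton] at hl
  refine ⟨1 + 1, _, le_rfl, Exec.seq (Exec.store s 0 (j + 1)) (Exec.op _ _ _ _ _ ?_), ?_⟩
  · simp [BinOp.eval, State.setMem, e1, hs.ptr]
    omega
  · refine ⟨fun i => ?_, ?_, fun i w hi => ?_, fun r hr => ?_⟩
    · simp only [State.setReg, State.setMem, Function.update_apply, hs.ptr, ej, hs.mem,
        ← List.append_assoc, List.getD_eq_getElem?_getD]
      rcases lt_trichotomy i (x ++ out).length with h | h | h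
      · rw [List.getElem?_append_left h, if_neg (by simp at h; omega)]
      · subst h; simp
      · simp at h
        rw [if_neg (by omega), List.getElem?_eq_none (by simp; omega),
          List.getElem?_eq_none (by simp; omega)]
    · simp [State.setReg, State.setMem, BinOp.eval, e1, hs.ptr]
      omega
    · simp [State.setReg, State.setMem, hs.env i w hi]
    · simp only [State.setReg, State.setMem, Function.update_apply]
      rw [if_neg (by omega), hs.high r hr]

/-- Append the contents of several registers to the output. -/
def _root_.WordRAM.Prog.emits : List ℕ → Prog
  | [] => Prog.skip
  | j :: js => Prog.seq (Prog.emit (j + 1)) (Prog.emits js)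

theorem emits (h1 : Γ[1]? = some 1) (js : List ℕ) (hf : js.map (fun j => Γ[j]?) = f.map some) :
    Runs W x Γ (Prog.emits js) (2 * js.length + 1) Γ f := by
  induction js generalizing f with
  | nil =>
    obtain rfl : f = [] := by simpa using hf.symm
    exact skip
  | cons j js ih =>
    match f, hf with
    | v :: f, hf =>
      simp only [List.map_cons, List.cons.injEq] at hf
      exact ((emit j h1 hf.1).seq (ih hf.2)).mono (by simp; omega)

/-- The loop instruction tests for nonzero, so counters run down to zero and the output appears in
decreasing order of the index. Pattern and text are therefore defined by `down`. -/
theorem loopDown (r N t : ℕ) (env : ℕ → List ℕ) (f : ℕ → List ℕ)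
    (hr : ∀ n, n ≤ N → (env n)[r]? = some n)
    (hp : ∀ n, n < N → Runs W x (env (n + 1)) p t (env n) (f n)) :
    Runs W x (env N) (Prog.loop (r + 1) p) (N * (t + 1) + 1) (env 0) (down f N) := by
  induction N with
  | zero =>
    intro s out _ hs
    exact ⟨1, s, by omega, Exec.loop_stop (hs.env r 0 (hr 0 le_rfl)), by
      rw [down, List.append_nil]; exact hs⟩
  | succ N ih =>
    intro s out hl hs
    simp only [down, List.length_append] at hl
    obtain ⟨k, s', hk, he, hs'⟩ := hp N (by omega) s out (by omega) hs
    obtain ⟨k', s'', hk', he', hs''⟩ := ih (fun n hn => hr n (by omega))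
      (fun n hn => hp n (by omega)) s' (out ++ f N) (by rw [List.length_append]; omega) hs'
    refine ⟨k + k' + 1, s'', by linarith, Exec.loop_step ?_ he he', ?_⟩
    · rw [hs.env r (N + 1) (hr _ le_rfl)]; omega
    · rwa [down, ← List.append_assoc]

/-- For loops that read a list from the input: the counter holds the number of unread items, `b`
collects pointer and accumulator, and `Inv` says that the pointer stands where the unread items are
stored. -/
theorem loopList {α β : Type*} (r : ℕ) (env : List α → β → List ℕ) (step : β → α → β)
    (Inv : List α → β → Prop) (f : α → List ℕ) (t : α → ℕ)
    (hr : ∀ l b, Inv l b → (env l b)[r]? = some l.length)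
    (hInv : ∀ a l b, Inv (a :: l) b → Inv l (step b a))
    (hp : ∀ a l b, Inv (a :: l) b → Runs W x (env (a :: l) b) p (t a) (env l (step b a)) (f a))
    (l : List α) (b : β) (hb : Inv l b) :
    Runs W x (env l b) (Prog.loop (r + 1) p) ((l.map fun a => t a + 1).sum + 1)
      (env [] (l.foldl step b)) (l.flatMap f) := by
  induction l generalizing b with
  | nil =>
    intro s out _ hs
    exact ⟨1, s, by omega, Exec.loop_stop (hs.env r 0 (hr [] b hb)), by simpa using hs⟩
  | cons a l ih =>
    intro s out hl hs
    simp only [List.flatMap_cons, List.length_append] at hl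
    obtain ⟨k, s', hk, he, hs'⟩ := hp a l b hb s out (by omega) hs
    obtain ⟨k', s'', hk', he', hs''⟩ := ih _ (hInv a l b hb) s' (out ++ f a)
      (by rw [List.length_append]; omega) hs'
    refine ⟨k + k' + 1, s'', ?_, Exec.loop_step ?_ he he', ?_⟩
    · simp only [List.map_cons, List.sum_cons]; omega
    · rw [hs.env r _ (hr _ b hb)]; simp
    · rwa [List.flatMap_cons, ← List.append_assoc]

end Runs

end WordRAM

namespace Regexp

/-! ### The pattern and the text -/

/-- The concatenation of the languages of a list of expressions. -/
def seqLang (es : List Regexp) : Language ℕ := (es.map lang).prod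

theorem lang_cat (es : List Regexp) : (cat es).lang = seqLang es := by
  simp [lang, seqLang]

theorem mem_seqLang_nil {w : List ℕ} : w ∈ seqLang [] ↔ w = [] := by
  simp [seqLang]

theorem mem_seqLang_append {es fs : List Regexp} {w : List ℕ} :
    w ∈ seqLang (es ++ fs) ↔ ∃ u ∈ seqLang es, ∃ v ∈ seqLang fs, u ++ v = w := by
  simp only [seqLang, List.map_append, List.prod_append, Language.mem_mul]

theorem append_mem_seqLang {es fs : List Regexp} {u v : List ℕ} (hu : u ∈ seqLang es)
    (hv : v ∈ seqLang fs) : u ++ v ∈ seqLang (es ++ fs) :=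
  mem_seqLang_append.2 ⟨u, hu, v, hv, rfl⟩

theorem mem_seqLang_letter {a : ℕ} {es : List Regexp} {w : List ℕ} :
    w ∈ seqLang (letter a :: es) ↔ ∃ v ∈ seqLang es, w = a :: v := by
  simp only [seqLang, List.map_cons, List.prod_cons, Language.mem_mul, lang]
  constructor
  · rintro ⟨u, hu, v, hv, rfl⟩
    rw [Set.mem_singleton_iff.1 hu]
    exact ⟨v, hv, rfl⟩
  · rintro ⟨v, hv, rfl⟩
    exact ⟨[a], rfl, v, hv, rfl⟩

theorem mem_lang_star_letter {a : ℕ} {w : List ℕ} :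
    w ∈ (star (letter a)).lang ↔ ∃ k, w = List.replicate k a := by
  simp only [lang, Language.mem_kstar]
  constructor
  · rintro ⟨L, rfl, hL⟩
    refine ⟨L.length, ?_⟩
    induction L with
    | nil => rfl
    | cons u L ih =>
      have hu : u = [a] := hL u (by simp)
      rw [List.flatten_cons, ih fun y hy => hL y (by simp [hy]), hu]
      rfl
  · rintro ⟨k, rfl⟩
    refine ⟨List.replicate k [a], by simp, fun y hy => ?_⟩
    rw [(List.mem_replicate.1 hy).2]
    rfl

theorem mem_seqLang_star {a : ℕ} {es : List Regexp} {w : List ℕ} :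
    w ∈ seqLang (star (letter a) :: es) ↔
      ∃ k, ∃ v ∈ seqLang es, w = List.replicate k a ++ v := by
  have : seqLang (star (letter a) :: es) = (star (letter a)).lang * seqLang es := by
    simp [seqLang]
  rw [this, Language.mem_mul]
  constructor
  · rintro ⟨u, hu, v, hv, rfl⟩
    obtain ⟨k, rfl⟩ := mem_lang_star_letter.1 hu
    exact ⟨k, v, hv, rfl⟩
  · rintro ⟨k, v, hv, rfl⟩
    exact ⟨_, mem_lang_star_letter.2 ⟨k, rfl⟩, v, hv, rfl⟩

theorem nil_mem_seqLang_stars (l : List ℕ) :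
    [] ∈ seqLang (l.map fun a => star (letter a)) := by
  induction l with
  | nil => exact mem_seqLang_nil.2 rfl
  | cons a l ih => exact mem_seqLang_star.2 ⟨0, [], ih, rfl⟩

theorem singleton_mem_seqLang_stars {l : List ℕ} {b : ℕ} (hb : b ∈ l) :
    [b] ∈ seqLang (l.map fun a => star (letter a)) := by
  induction l with
  | nil => simp at hb
  | cons a l ih =>
    rw [List.map_cons, mem_seqLang_star]
    by_cases h : b = a
    · exact ⟨1, [], nil_mem_seqLang_stars l, by simp [h]⟩
    · exact ⟨0, [b], ih (by simpa [h] using hb), rfl⟩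

/-- `n` copies of the concatenation of the stars of the letters in `l`. -/
def filler (l : List ℕ) (n : ℕ) : List Regexp := down (fun _ => l.map fun a => star (letter a)) n

/-- Each copy of the product of stars can absorb one arbitrary letter of `l`, and unused copies
produce the empty word. -/
theorem mem_seqLang_filler {l : List ℕ} {n : ℕ} {w : List ℕ} (hl : w.length ≤ n)
    (hw : ∀ b ∈ w, b ∈ l) : w ∈ seqLang (filler l n) := by
  induction n generalizing w with
  | zero =>
    obtain rfl : w = [] := by simpa using hl
    exact mem_seqLang_nil.2 rfl
  | succ n ih =>
    match w with
    | [] => exact append_mem_seqLang (nil_mem_seqLang_stars l) (ih (w := []) (by simp) (by simp))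
    | b :: w =>
      exact append_mem_seqLang (u := [b]) (singleton_mem_seqLang_stars (hw b (by simp)))
        (ih (by simpa using hl) fun c hc => hw c (by simp [hc]))

theorem mem_of_mem_seqLang_filler {l : List ℕ} {n : ℕ} {w : List ℕ}
    (hw : w ∈ seqLang (filler l n)) {b : ℕ} (hb : b ∈ w) : b ∈ l := by
  have stars : ∀ (l : List ℕ) (w : List ℕ), w ∈ seqLang (l.map fun a => star (letter a)) →
      ∀ b ∈ w, b ∈ l := by
    intro l
    induction l with
    | nil => intro w hw b hb; rw [mem_seqLang_nil.1 hw] at hb; simp at hb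
    | cons a l ih =>
      intro w hw b hb
      obtain ⟨k, v, hv, rfl⟩ := mem_seqLang_star.1 hw
      rcases List.mem_append.1 hb with h | h
      · simp [(List.mem_replicate.1 h).2]
      · exact List.mem_cons_of_mem _ (ih v hv b h)
  induction n generalizing w with
  | zero => rw [mem_seqLang_nil.1 hw] at hb; simp at hb
  | succ n ih =>
    obtain ⟨u, hu, v, hv, rfl⟩ := mem_seqLang_append.1 hw
    rcases List.mem_append.1 hb with h | h
    exacts [stars l u hu b h, ih hv h]

/-! ### Vectors as words -/

/-- The expression for a coordinate `v` of a vector of the pattern. -/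
def coordPattern (v : ℕ) : List Regexp := [star (letter 0), star (letter v), letter 2]

/-- The word for a vector of the text. -/
def vecText (vs : List ℕ) : List ℕ := vs.flatMap fun v => [v, 2]

/-- The expression for a vector of the pattern: it is matched with one vector of the text, and one
or two more vectors of the text are skipped. -/
def block (E : ℕ) (vs : List ℕ) : List Regexp :=
  letter 3 :: (vs.flatMap coordPattern ++
    letter 3 :: (filler [0, 1, 2] E ++ star (letter 3) :: filler [0, 1, 2] E))

/-- The pattern for the vectors `va (n - 1), …, va 0`. -/
def pattern (va : ℕ → List ℕ) (n E K : ℕ) : List Regexp :=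
  filler [0, 1, 2, 3] K ++ (down (fun i => block E (va i)) n ++ (filler [0, 1, 2, 3] K ++
    [letter 4]))

/-- The text for the vectors `vb (G - 1), …, vb 0`. -/
def text (vb : ℕ → List ℕ) (G : ℕ) : List ℕ := down (fun g => 3 :: vecText (vb g)) G

/-- No coordinate of `vs` is `0` where the one of `ws` is `1`. -/
def Compatible (vs ws : List ℕ) : Prop := List.Forall₂ (fun a b => b = 0 ∨ b = a) vs ws

theorem vecText_mem_of_compatible {vs ws : List ℕ} (h : Compatible vs ws) :
    vecText ws ∈ seqLang (vs.flatMap coordPattern) := by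
  induction h with
  | nil => exact mem_seqLang_nil.2 rfl
  | @cons a b vs ws hab _ ih =>
    rw [vecText, List.flatMap_cons, List.flatMap_cons]
    refine append_mem_seqLang ?_ ih
    rw [coordPattern, mem_seqLang_star]
    have h2 : [2] ∈ seqLang [letter 2] := mem_seqLang_letter.2 ⟨[], mem_seqLang_nil.2 rfl, rfl⟩
    rcases hab with rfl | rfl
    · exact ⟨1, [2], mem_seqLang_star.2 ⟨0, [2], h2, rfl⟩, rfl⟩
    · exact ⟨0, [b, 2], mem_seqLang_star.2 ⟨1, [2], h2, rfl⟩, rfl⟩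

/-- Parsing is forced: each coordinate of either side ends at a 2, and the text has exactly one
letter before it. The remainders `r`, `r'` allow the lemma to be applied to a prefix of a longer
text. -/
theorem compatible_of_mem {vs ws : List ℕ} (hvs : ∀ v ∈ vs, v ≤ 1) (hws : ∀ v ∈ ws, v ≤ 1)
    (hl : vs.length = ws.length) {w r r' : List ℕ} (hw : w ∈ seqLang (vs.flatMap coordPattern))
    (h : w ++ r = vecText ws ++ r') : Compatible vs ws ∧ r = r' := by
  induction vs generalizing ws w with
  | nil =>
    obtain rfl : ws = [] := by simpa using hl.symm
    rw [mem_seqLang_nil.1 hw] at h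
    exact ⟨List.Forall₂.nil, h⟩
  | cons a vs ih =>
    match ws, hl with
    | b :: ws, hl =>
      rw [List.flatMap_cons] at hw
      obtain ⟨u, hu, w', hw', rfl⟩ := mem_seqLang_append.1 hw
      obtain ⟨p, v, hv, rfl⟩ := mem_seqLang_star.1 hu
      obtain ⟨q, v', hv', rfl⟩ := mem_seqLang_star.1 hv
      obtain ⟨v'', hv'', rfl⟩ := mem_seqLang_letter.1 hv'
      obtain rfl := mem_seqLang_nil.1 hv''
      have ha := hvs a (by simp)
      have hb := hws b (by simp)
      have key : (b = 0 ∨ b = a) ∧ w' ++ r = vecText ws ++ r' := by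
        simp only [vecText, List.flatMap_cons] at h ⊢
        -- `p` and `q` are the numbers of repetitions in `0* a*`. Exactly one letter has to be
        -- produced: none would place the 2 against `b ≤ 1`, and two would place a letter at most 1
        -- against the 2.
        match p, q with
        | 0, 0 => simp at h; omega
        | 0, 1 => simp at h; exact ⟨Or.inr h.1.symm, by simpa using h.2⟩
        | 0, q + 2 => simp [List.replicate_succ] at h; omega
        | 1, 0 => simp at h; exact ⟨Or.inl h.1.symm, by simpa using h.2⟩
        | 1, q + 1 => simp [List.replicate_succ] at h; omega
        | p + 2, q => simp [List.replicate_succ] at h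
      obtain ⟨h1, h2⟩ := ih (fun v hv => hvs v (by simp [hv])) (fun v hv => hws v (by simp [hv]))
        (by simpa using hl) hw' key.2
      exact ⟨List.Forall₂.cons key.1 h1, h2⟩

theorem le_two_of_mem_vecText {ws : List ℕ} (hws : ∀ v ∈ ws, v ≤ 1) {v : ℕ}
    (hv : v ∈ vecText ws) : v ≤ 2 := by
  simp only [vecText, List.mem_flatMap] at hv
  obtain ⟨a, ha, h⟩ := hv
  have := hws a ha
  simp at h
  omega

theorem length_vecText (ws : List ℕ) : (vecText ws).length = 2 * ws.length := by
  induction ws with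
  | nil => rfl
  | cons a ws ih => rw [vecText, List.flatMap_cons, ← vecText]; simp [ih]; omega

theorem text_succ (vb : ℕ → List ℕ) (G : ℕ) : text vb (G + 1) = 3 :: (vecText (vb G) ++ text vb G) :=
  rfl

theorem length_text {vb : ℕ → List ℕ} {D : ℕ} (hD : ∀ g, (vb g).length = D) (G : ℕ) :
    (text vb G).length = G * (2 * D + 1) := by
  induction G with
  | zero => simp [text, down]
  | succ G ih => simp [text_succ, length_vecText, hD, ih]; ring

theorem le_three_of_mem_text {vb : ℕ → List ℕ} (hvb : ∀ g, ∀ v ∈ vb g, v ≤ 1) {G v : ℕ}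
    (hv : v ∈ text vb G) : v ≤ 3 := by
  induction G with
  | zero => simp [text, down] at hv
  | succ G ih =>
    rw [text_succ, List.mem_cons, List.mem_append] at hv
    rcases hv with rfl | hv | hv
    exacts [le_rfl, (le_two_of_mem_vecText (hvb G) hv).trans (by norm_num), ih hv]

theorem count_text {vb : ℕ → List ℕ} (hvb : ∀ g, ∀ v ∈ vb g, v ≤ 1) (G : ℕ) :
    (text vb G).count 3 = G := by
  induction G with
  | zero => rfl
  | succ G ih =>
    rw [text_succ, List.count_cons_self, List.count_append, ih, List.count_eq_zero_of_not_mem]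
    · omega
    · exact fun h => absurd (le_two_of_mem_vecText (hvb G) h) (by norm_num)

/-- The letter 3 occurs only at the start of a vector, so a suffix that starts with 3 is cut at a
vector boundary. -/
theorem eq_text_of_suffix {vb : ℕ → List ℕ} (hvb : ∀ g, ∀ v ∈ vb g, v ≤ 1) {G : ℕ}
    {u r : List ℕ} (h : u ++ 3 :: r = text vb G) : ∃ g, g ≤ G ∧ 3 :: r = text vb g := by
  induction G generalizing u with
  | zero => simp [text, down] at h
  | succ G ih =>
    match u with
    | [] => exact ⟨G + 1, le_rfl, h⟩
    | a :: u =>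
      rw [text_succ, List.cons_append, List.cons.injEq] at h
      rcases List.append_eq_append_iff.1 h.2 with ⟨c, h1, h2⟩ | ⟨c, h1, h2⟩
      · match c with
        | [] =>
          obtain ⟨g, hg, h3⟩ := ih (u := []) (by simpa using h2)
          exact ⟨g, by omega, h3⟩
        | b :: c =>
          rw [List.cons_append, List.cons.injEq] at h2
          have : b ∈ vecText (vb G) := by rw [h1]; simp
          have := le_two_of_mem_vecText (hvb G) this
          omega
      · obtain ⟨g, hg, h3⟩ := ih h2.symm
        exact ⟨g, by omega, h3⟩

/-- After a 3 comes the first coordinate of a nonempty vector, which is at most 1. This limits the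
`3*` of a block to one use. -/
theorem text_ne_of_repeated {vb : ℕ → List ℕ} (hvb : ∀ g, ∀ v ∈ vb g, v ≤ 1)
    (hne : ∀ g, vb g ≠ []) {G : ℕ} {u r : List ℕ} : u ++ 3 :: 3 :: r ≠ text vb G := by
  intro h
  obtain ⟨g, _, hg⟩ := eq_text_of_suffix hvb h
  match g with
  | 0 => simp [text, down] at hg
  | g + 1 =>
    rw [text_succ, List.cons.injEq] at hg
    cases hv : vb g with
    | nil => exact hne g hv
    | cons b bs =>
      have hb := hvb g b (by simp [hv])
      rw [hv, vecText, List.flatMap_cons] at hg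
      simp at hg
      omega

/-! ### Alignments of the pattern with the text -/

/-- The `i`-th vector of the pattern can be matched with the vector number `g i` of the text, with
one or two vectors of the text between neighbours. -/
structure Aligned (va vb : ℕ → List ℕ) (n G : ℕ) (g : ℕ → ℕ) : Prop where
  compatible : ∀ i < n, Compatible (va i) (vb (g i))
  step : ∀ i, i + 1 < n → g (i + 1) = g i + 2 ∨ g (i + 1) = g i + 3
  first : 1 ≤ g 0
  last : g (n - 1) < G

/-- The topmost block is parsed first and the rest is handled by induction. The number of text
vectors that a block consumes is its number of letters 3, namely `2 + k` with `k ≤ 1` the number of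
repetitions in its `3*`. -/
theorem aligned_of_mem_blocks {va vb : ℕ → List ℕ} (hva : ∀ i, ∀ v ∈ va i, v ≤ 1)
    (hvb : ∀ g, ∀ v ∈ vb g, v ≤ 1) (hne : ∀ g, vb g ≠ [])
    (hl : ∀ i g, (va i).length = (vb g).length) {E n G : ℕ} {w r : List ℕ}
    (hw : w ∈ seqLang (down (fun i => block E (va i)) (n + 1))) (h : w ++ r = text vb (G + 1)) :
    ∃ g, g n = G ∧ Aligned va vb (n + 1) (G + 1) g := by
  induction n generalizing G w with
  | zero =>
    simp only [down, List.append_nil] at hw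
    obtain ⟨w', hw', rfl⟩ := mem_seqLang_letter.1 hw
    obtain ⟨w1, hw1, w2, hw2, rfl⟩ := mem_seqLang_append.1 hw'
    obtain ⟨w3, hw3, rfl⟩ := mem_seqLang_letter.1 hw2
    rw [text_succ, List.cons_append, List.cons.injEq, List.append_assoc] at h
    obtain ⟨hc, hr⟩ := compatible_of_mem (hva 0) (hvb G) (hl 0 G) hw1 h.2
    -- The second 3 of the block needs one more text vector to skip.
    have hG : 1 ≤ G := by
      rcases G with _ | G
      · simp [text, down] at hr
      · omega
    refine ⟨fun _ => G, rfl, fun i hi => ?_, fun i hi => by omega, hG, by simp⟩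
    obtain rfl : i = 0 := by omega
    exact hc
  | succ n ih =>
    rw [down] at hw
    obtain ⟨w₁, hw₁, c, hc, rfl⟩ := mem_seqLang_append.1 hw
    obtain ⟨w', hw', rfl⟩ := mem_seqLang_letter.1 hw₁
    obtain ⟨w1, hw1, w2, hw2, rfl⟩ := mem_seqLang_append.1 hw'
    obtain ⟨w3, hw3, rfl⟩ := mem_seqLang_letter.1 hw2
    obtain ⟨w4, hw4, w5, hw5, rfl⟩ := mem_seqLang_append.1 hw3
    obtain ⟨k, w6, hw6, rfl⟩ := mem_seqLang_star.1 hw5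
    rw [text_succ, List.cons_append, List.cons_append, List.cons.injEq, List.append_assoc,
      List.append_assoc] at h
    obtain ⟨hcomp, hr⟩ := compatible_of_mem (hva _) (hvb G) (hl _ G) hw1 h.2
    have hk : k ≤ 1 := by
      by_contra hk
      obtain ⟨k, rfl⟩ : ∃ k', k = k' + 2 := ⟨k - 2, by omega⟩
      refine text_ne_of_repeated (G := G) hvb hne
        (u := 3 :: w4) (r := List.replicate k 3 ++ (w6 ++ (c ++ r))) ?_
      rw [← hr]
      simp [List.replicate_succ]
    obtain ⟨c', hc'⟩ : ∃ c', c = 3 :: c' := by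
      rw [down, block, List.cons_append] at hc
      obtain ⟨c', _, hc'⟩ := mem_seqLang_letter.1 hc
      exact ⟨c', hc'⟩
    obtain ⟨G', _, hG'⟩ := eq_text_of_suffix (G := G)
      (u := 3 :: (w4 ++ (List.replicate k 3 ++ w6))) (r := c' ++ r) hvb
      (by rw [← hr, hc']; simp)
    rw [← List.cons_append, ← hc'] at hG'
    -- Compare the numbers of 3s behind the matched vector: the fillers contain none, so there are
    -- `1 + k` left in this block and `G'` in the remaining text.
    have hcount : 1 + k + G' = G := by
      have nc : ∀ {u : List ℕ}, u ∈ seqLang (filler [0, 1, 2] E) → u.count 3 = 0 := by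
        intro u hu
        refine List.count_eq_zero_of_not_mem fun h3 => ?_
        simpa using mem_of_mem_seqLang_filler hu h3
      have h1 := congrArg (List.count 3) hr
      have h2 := congrArg (List.count 3) hG'
      rw [count_text hvb] at h1 h2
      simp [nc hw4, nc hw6] at h1 h2
      omega
    obtain ⟨G', rfl⟩ : ∃ G'', G' = G'' + 1 := by
      rcases G' with _ | G'
      · simp [text, down, hc'] at hG'
      · exact ⟨G', rfl⟩
    obtain ⟨g, hgn, hg⟩ := ih hc hG'
    refine ⟨Function.update g (n + 1) G, by simp, fun i hi => ?_, fun i hi => ?_, ?_, ?_⟩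
    · rcases eq_or_ne i (n + 1) with rfl | hne'
      · simpa using hcomp
      · rw [Function.update_of_ne hne']
        exact hg.compatible i (by omega)
    · rw [Function.update_of_ne (by omega : i ≠ n + 1)]
      rcases eq_or_ne i n with rfl | hne'
      · rw [Function.update_self]
        omega
      · rw [Function.update_of_ne (by omega)]
        exact hg.step i (by omega)
    · rw [Function.update_of_ne (by omega)]
      exact hg.first
    · simp

theorem exists_text_append (vb : ℕ → List ℕ) {g G : ℕ} (h : g ≤ G) :
    ∃ u, text vb G = u ++ text vb g := by
  induction G, h using Nat.le_induction with
  | base => exact ⟨[], rfl⟩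
  | succ G _ ih =>
    obtain ⟨u, hu⟩ := ih
    exact ⟨3 :: (vecText (vb G) ++ u), by rw [text_succ, hu]; simp⟩

/-- To skip one vector, the first filler absorbs it while `3*` and the second filler are empty
(`hone`); to skip two, `3*` is used once and each filler absorbs one vector (`htwo`). Block `0`
always skips one, which `1 ≤ g 0` permits. -/
theorem mem_blocks_of_aligned {va vb : ℕ → List ℕ} (hvb : ∀ g, ∀ v ∈ vb g, v ≤ 1)
    {D E n : ℕ} (hD : ∀ g, (vb g).length = D) (hE : 2 * D ≤ E) {g : ℕ → ℕ}
    (hcomp : ∀ i < n + 1, Compatible (va i) (vb (g i)))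
    (hstep : ∀ i, i + 1 < n + 1 → g (i + 1) = g i + 2 ∨ g (i + 1) = g i + 3)
    (hfirst : 1 ≤ g 0) :
    ∃ w ∈ seqLang (down (fun i => block E (va i)) (n + 1)), ∃ r, w ++ r = text vb (g n + 1) := by
  have hfill : ∀ j, vecText (vb j) ∈ seqLang (filler [0, 1, 2] E) := fun j =>
    mem_seqLang_filler (by rw [length_vecText, hD]; omega) fun b hb => by
      have := le_two_of_mem_vecText (hvb j) hb
      simp; omega
  have hnil : [] ∈ seqLang (filler [0, 1, 2] E) := mem_seqLang_filler (by simp) (by simp)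
  have hone : ∀ i j, Compatible (va i) (vb (j + 1)) →
      3 :: (vecText (vb (j + 1)) ++ 3 :: (vecText (vb j) ++ [])) ∈ seqLang (block E (va i)) :=
    fun i j h => mem_seqLang_letter.2 ⟨_, append_mem_seqLang (vecText_mem_of_compatible h)
      (mem_seqLang_letter.2 ⟨_, append_mem_seqLang (hfill j)
        (mem_seqLang_star.2 ⟨0, _, hnil, rfl⟩), rfl⟩), rfl⟩
  have htwo : ∀ i j, Compatible (va i) (vb (j + 2)) →
      3 :: (vecText (vb (j + 2)) ++ 3 :: (vecText (vb (j + 1)) ++ 3 :: vecText (vb j))) ∈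
        seqLang (block E (va i)) :=
    fun i j h => mem_seqLang_letter.2 ⟨_, append_mem_seqLang (vecText_mem_of_compatible h)
      (mem_seqLang_letter.2 ⟨_, append_mem_seqLang (hfill (j + 1))
        (mem_seqLang_star.2 ⟨1, _, hfill j, rfl⟩), rfl⟩), rfl⟩
  induction n with
  | zero =>
    obtain ⟨j, hj⟩ : ∃ j, g 0 = j + 1 := ⟨g 0 - 1, by omega⟩
    have h0 := hcomp 0 (by omega)
    rw [hj] at h0 ⊢
    refine ⟨_, by simpa [down] using hone 0 j h0, text vb j, ?_⟩
    simp [text_succ]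
  | succ n ih =>
    obtain ⟨w, hw, r, hr⟩ := ih (fun i hi => hcomp i (by omega)) (fun i hi => hstep i (by omega))
    have h0 := hcomp (n + 1) (by omega)
    rcases hstep n (by omega) with hs | hs
    · rw [hs] at h0 ⊢
      refine ⟨_, append_mem_seqLang (hone (n + 1) _ h0) hw, r, ?_⟩
      rw [List.append_assoc, hr]
      simp [text_succ]
    · rw [hs] at h0 ⊢
      refine ⟨_, append_mem_seqLang (htwo (n + 1) _ h0) hw, r, ?_⟩
      rw [List.append_assoc, hr]
      simp [text_succ]

/-- The outer fillers are long enough to absorb any part of the text, so the blocks may start at any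
vector. In the other direction, blocks start with 3 and thus at a vector boundary. -/
theorem text_mem_pattern_iff {va vb : ℕ → List ℕ} (hva : ∀ i, ∀ v ∈ va i, v ≤ 1)
    (hvb : ∀ g, ∀ v ∈ vb g, v ≤ 1) {D : ℕ} (hD0 : D ≠ 0) (haD : ∀ i, (va i).length = D)
    (hbD : ∀ g, (vb g).length = D) {E n G K : ℕ} (hE : 2 * D ≤ E) (hK : G * (2 * D + 1) ≤ K) :
    text vb G ++ [4] ∈ (cat (pattern va (n + 1) E K)).lang ↔
      ∃ g, Aligned va vb (n + 1) G g := by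
  rw [lang_cat, pattern]
  constructor
  · intro h
    obtain ⟨u, _, v, hv, huv⟩ := mem_seqLang_append.1 h
    obtain ⟨w, hw, v', hv', rfl⟩ := mem_seqLang_append.1 hv
    obtain ⟨r, _, e, he, rfl⟩ := mem_seqLang_append.1 hv'
    obtain ⟨e', he', rfl⟩ := mem_seqLang_letter.1 he
    rw [mem_seqLang_nil.1 he', ← List.append_assoc, ← List.append_assoc] at huv
    have huv' := List.append_cancel_right huv
    obtain ⟨w', hw'⟩ : ∃ w', w = 3 :: w' := by
      rw [down, block, List.cons_append] at hw
      obtain ⟨c', _, hc'⟩ := mem_seqLang_letter.1 hw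
      exact ⟨c', hc'⟩
    rw [List.append_assoc] at huv'
    obtain ⟨G', hG, hG'⟩ := eq_text_of_suffix (u := u) (r := w' ++ r) hvb
      (by rw [← huv', hw']; simp)
    rw [← List.cons_append, ← hw'] at hG'
    obtain ⟨G', rfl⟩ : ∃ G'', G' = G'' + 1 := by
      rcases G' with _ | G'
      · simp [text, down, hw'] at hG'
      · exact ⟨G', rfl⟩
    obtain ⟨g, _, hg⟩ := aligned_of_mem_blocks hva hvb
      (fun g h0 => hD0 (by rw [← hbD g, h0]; rfl)) (fun i g => by rw [haD, hbD]) hw hG'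
    exact ⟨g, hg.compatible, hg.step, hg.first, hg.last.trans_le hG⟩
  · rintro ⟨g, hg⟩
    obtain ⟨w, hw, r, hr⟩ := mem_blocks_of_aligned hvb hbD hE hg.compatible hg.step hg.first
    obtain ⟨u, hu⟩ := exists_text_append vb (Nat.succ_le_of_lt hg.last)
    rw [Nat.add_sub_cancel, ← hr] at hu
    have hlen := length_text hbD G
    rw [hu] at hlen
    simp only [List.length_append] at hlen
    have hmem : ∀ b ∈ text vb G, b ∈ [0, 1, 2, 3] := fun b hb => by
      have := le_three_of_mem_text hvb hb
      simp; omega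
    rw [hu] at hmem ⊢
    rw [List.append_assoc, List.append_assoc]
    refine append_mem_seqLang (mem_seqLang_filler (by omega) fun b hb => hmem b (by simp [hb]))
      (append_mem_seqLang hw (append_mem_seqLang
        (mem_seqLang_filler (by omega) fun b hb => hmem b (by simp [hb]))
        (mem_seqLang_letter.2 ⟨[], mem_seqLang_nil.2 rfl, rfl⟩)))

end Regexp

/-! ### Formulas as patterns and texts -/

/-- Whether the literal with code `l` is true for the bits of `I`, where only the variables below
`h` count if `σ = 1`, and only the others if `σ = 0`. -/
def litVal (h I σ l : ℕ) : ℕ :=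
  (if (I >>> (l / 2)) % 2 = l % 2 then 1 else 0) * (if (if l / 2 < h then 1 else 0) = σ then 1 else 0)

/-- Whether some literal of a clause is true in the sense of `litVal`. -/
def clauseVal (h I σ : ℕ) (cl : List ℕ) : ℕ := cl.foldl (fun acc l => acc ||| litVal h I σ l) 0

theorem litVal_le (h I σ l : ℕ) : litVal h I σ l ≤ 1 := by
  unfold litVal
  split_ifs <;> simp

theorem foldl_or_litVal (h I σ : ℕ) (cl : List ℕ) {b : ℕ} (hb : b ≤ 1) :
    cl.foldl (fun acc l => acc ||| litVal h I σ l) b ≤ 1 ∧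
      (cl.foldl (fun acc l => acc ||| litVal h I σ l) b = 1 ↔ b = 1 ∨ ∃ l ∈ cl, litVal h I σ l = 1) := by
  induction cl generalizing b with
  | nil => simpa using hb
  | cons l cl ih =>
    have hl := litVal_le h I σ l
    have key : b ||| litVal h I σ l ≤ 1 ∧ (b ||| litVal h I σ l = 1 ↔ b = 1 ∨ litVal h I σ l = 1) := by
      generalize litVal h I σ l = c at hl
      interval_cases b <;> interval_cases c <;> simp
    obtain ⟨h1, h2⟩ := ih key.1
    rw [List.foldl_cons]
    refine ⟨h1, h2.trans ?_⟩
    rw [key.2]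
    simp [or_assoc]

theorem clauseVal_le (h I σ : ℕ) (cl : List ℕ) : clauseVal h I σ cl ≤ 1 :=
  (foldl_or_litVal h I σ cl (by norm_num)).1

theorem clauseVal_eq_one {h I σ : ℕ} {cl : List ℕ} :
    clauseVal h I σ cl = 1 ↔ ∃ l ∈ cl, litVal h I σ l = 1 :=
  (foldl_or_litVal h I σ cl (by norm_num)).2.trans (by simp)

theorem litVal_eq_one {n : ℕ} {h I σ : ℕ} (l : Fin n × Bool) :
    litVal h I σ (2 * (l.1 : ℕ) + l.2.toNat) = 1 ↔
      I.testBit l.1 = l.2 ∧ (if (l.1 : ℕ) < h then 1 else 0) = σ := by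
  have h1 : (2 * (l.1 : ℕ) + l.2.toNat) / 2 = l.1 := by cases l.2 <;> (simp; try omega)
  have h2 : (2 * (l.1 : ℕ) + l.2.toNat) % 2 = l.2.toNat := by cases l.2 <;> simp
  rw [litVal, h1, h2, Nat.testBit_eq_decide_div_mod_eq, Nat.shiftRight_eq_div_pow]
  have h3 : ((I / 2 ^ (l.1 : ℕ)) % 2 = l.2.toNat) ↔
      decide (I / 2 ^ (l.1 : ℕ) % 2 = 1) = l.2 := by
    rcases Nat.mod_two_eq_zero_or_one (I / 2 ^ (l.1 : ℕ)) with h | h <;> rw [h] <;> cases l.2 <;> simp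
  have ite : ∀ (P : Prop) [Decidable P], (if P then 1 else 0) = 1 ↔ P := by simp
  rw [← h3, mul_eq_one, ite, ite]

namespace CNFFormula

variable {n : ℕ}

/-- The codes of the literals of a formula. -/
def codes (φ : CNFFormula n) : List (List ℕ) :=
  φ.map fun cl => cl.map fun l => 2 * (l.1 : ℕ) + l.2.toNat

end CNFFormula

/-- The vector number `i` of the pattern for the clauses `cls`. -/
def patternVec (h : ℕ) (cls : List (List ℕ)) (i : ℕ) : List ℕ :=
  cls.map (clauseVal h i 1) ++ [if 0 < i then 1 else 0, if i < 2 ^ h + 1 then 1 else 0]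

/-- The vector number `g` of the text for the clauses `cls`. -/
def textVec (h : ℕ) (cls : List (List ℕ)) (g : ℕ) : List ℕ :=
  cls.map (fun cl =>
    if clauseVal h (g / 3 * 2 ^ h) 0 cl < (if g % 3 = 1 then 1 else 0) then 1 else 0) ++
    [if g % 3 < 2 then 1 else 0, if 0 < g % 3 then 1 else 0]

theorem patternVec_le (h : ℕ) (cls : List (List ℕ)) (i : ℕ) : ∀ v ∈ patternVec h cls i, v ≤ 1 := by
  intro v hv
  simp only [patternVec, List.mem_append, List.mem_map, List.mem_cons, List.not_mem_nil,
    or_false] at hv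
  rcases hv with ⟨cl, _, rfl⟩ | rfl | rfl
  · exact clauseVal_le _ _ _ _
  all_goals split_ifs <;> simp

theorem textVec_le (h : ℕ) (cls : List (List ℕ)) (g : ℕ) : ∀ v ∈ textVec h cls g, v ≤ 1 := by
  intro v hv
  simp only [textVec, List.mem_append, List.mem_map, List.mem_cons, List.not_mem_nil,
    or_false] at hv
  rcases hv with ⟨cl, _, rfl⟩ | rfl | rfl
  all_goals split_ifs <;> simp

theorem length_patternVec (h : ℕ) (cls : List (List ℕ)) (i : ℕ) :
    (patternVec h cls i).length = cls.length + 2 := by simp [patternVec]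

theorem length_textVec (h : ℕ) (cls : List (List ℕ)) (g : ℕ) :
    (textVec h cls g).length = cls.length + 2 := by simp [textVec]

theorem compatible_map_append {ι : Type*} (l : List ι) (f f' : ι → ℕ) (a b c d : ℕ) :
    Regexp.Compatible (l.map f ++ [a, b]) (l.map f' ++ [c, d]) ↔
      (∀ x ∈ l, f' x = 0 ∨ f' x = f x) ∧ (c = 0 ∨ c = a) ∧ (d = 0 ∨ d = b) := by
  unfold Regexp.Compatible
  induction l with
  | nil => simp
  | cons x l ih => simp [ih, and_assoc]

theorem exists_testBit (h : ℕ) (f : ℕ → Bool) : ∃ i < 2 ^ h, ∀ x < h, i.testBit x = f x :=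
  ⟨Nat.ofBits fun x : Fin h => f x, Nat.ofBits_lt_two_pow _, fun x hx =>
    Nat.testBit_ofBits_lt _ x hx⟩

/-- A step of 3 keeps the residue and a step of 2 turns 2 into 1, so residue 0 cannot be reached
from 2 without passing through 1. -/
theorem exists_index_mod_three {g : ℕ → ℕ} {n : ℕ} (h0 : g 0 % 3 = 2) (hn : g n % 3 = 0)
    (hstep : ∀ i, i + 1 < n + 1 → g (i + 1) = g i + 2 ∨ g (i + 1) = g i + 3) :
    ∃ i ≤ n, g i % 3 = 1 := by
  by_contra! hne
  have : ∀ i ≤ n, g i % 3 = 2 := by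
    intro i
    induction i with
    | zero => exact fun _ => h0
    | succ i ih =>
      intro hi
      have h1 := ih (by omega)
      have h2 := hne (i + 1) hi
      have h3 := hstep i (by omega)
      omega
  have := this n le_rfl
  omega

/-- A block at residue 1 is compared with a genuine text vector, and compatibility says that every
clause is satisfied by the lower or by the upper assignment. The last two coordinates exclude block
`0` from residues 0 and 1, and block `2 ^ h + 1` from residues 1 and 2. -/
theorem satisfiable_iff_aligned {n h : ℕ} (hn : n ≤ 2 * h) (φ : CNFFormula n) :
    φ.Satisfiable ↔ ∃ g, Regexp.Aligned (patternVec h φ.codes) (textVec h φ.codes) (2 ^ h + 1 + 1)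
      (9 * 2 ^ h) g := by
  have hM : 0 < 2 ^ h := by positivity
  constructor
  · rintro ⟨v, hv⟩
    -- Bit positions that belong to no variable are filled with `false`.
    obtain ⟨i', hi', hbit⟩ := exists_testBit h fun x => if hx : x < n then v ⟨x, hx⟩ else false
    obtain ⟨j, hj, hbit'⟩ :=
      exists_testBit h fun x => if hx : x + h < n then v ⟨x + h, hx⟩ else false
    -- Index `0` is the starting block and cannot meet a genuine vector; `2 ^ h` has the same bits
    -- below `h` and represents the zero assignment instead.
    obtain ⟨i₀, h1, h2, hi₀⟩ : ∃ i₀, 1 ≤ i₀ ∧ i₀ ≤ 2 ^ h ∧ ∀ x < h, i₀.testBit x = i'.testBit x := by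
      rcases Nat.eq_zero_or_pos i' with h0 | h0
      · refine ⟨2 ^ h, hM, le_rfl, fun x hx => ?_⟩
        rw [h0, Nat.testBit_two_pow_of_ne (by omega), Nat.zero_testBit]
      · exact ⟨i', h0, hi'.le, fun _ _ => rfl⟩
    -- The summand `2 ^ h` leaves the `h` low bits unchanged and makes `J ≥ i₀`, so that there is
    -- room in the text for the blocks below `i₀`. The largest index used is at most `9 * 2 ^ h -
    -- 3`.
    set J := 2 ^ h + j with hJ
    have key : ∀ cl ∈ φ.codes, clauseVal h i₀ 1 cl = 1 ∨ clauseVal h (J * 2 ^ h) 0 cl = 1 := by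
      intro cl hcl
      obtain ⟨cl, hcl', rfl⟩ := List.mem_map.1 hcl
      obtain ⟨l, hl, hvl⟩ := hv cl hcl'
      simp only [clauseVal_eq_one, List.mem_map]
      by_cases hlt : (l.1 : ℕ) < h
      · refine Or.inl ⟨_, ⟨l, hl, rfl⟩, (litVal_eq_one l).2 ⟨?_, by simp [hlt]⟩⟩
        rw [hi₀ _ hlt, hbit _ hlt, dif_pos l.1.2, ← hvl]
      · refine Or.inr ⟨_, ⟨l, hl, rfl⟩, (litVal_eq_one l).2 ⟨?_, by simp [hlt]⟩⟩
        have hl1 := l.1.2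
        have hlt' : (l.1 : ℕ) - h < h := by omega
        rw [Nat.testBit_mul_two_pow, decide_eq_true (by omega : h ≤ (l.1 : ℕ)), Bool.true_and, hJ,
          Nat.testBit_two_pow_add_gt hlt', hbit' _ hlt', dif_pos (show (l.1 : ℕ) - h + h < n by omega), ← hvl]
        exact congrArg v (Fin.ext (Nat.sub_add_cancel (not_lt.1 hlt)))
    -- All steps are 3 except the two next to `i₀`, which are 2 and change the residue from 2 to 1
    -- and from 1 to 0.
    refine ⟨fun i => if i < i₀ then 3 * (J + i - i₀) + 2 else if i = i₀ then 3 * J + 1 else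
      3 * (J + i - i₀), fun i hi => ?_, fun i hi => ?_, ?_, ?_⟩
    · rw [patternVec, textVec, compatible_map_append]
      rcases lt_trichotomy i i₀ with hlt | rfl | hlt
      · simp only [if_pos hlt]
        have e1 : (3 * (J + i - i₀) + 2) % 3 = 2 := by omega
        simp [e1]
        omega
      · simp only [lt_irrefl, if_false, if_true]
        have e1 : (3 * J + 1) % 3 = 1 := by omega
        have e2 : (3 * J + 1) / 3 = J := by omega
        simp only [e1, e2]
        refine ⟨fun cl hcl => ?_, Or.inr ?_, Or.inr ?_⟩
        · rcases key cl hcl with hk | hk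
          · rw [hk]; split_ifs <;> simp
          · simp [hk]
        · simp; omega
        · simp; omega
      · simp only [if_neg hlt.not_gt, if_neg hlt.ne']
        have e1 : (3 * (J + i - i₀)) % 3 = 0 := by omega
        simp [e1]
        omega
    · split_ifs <;> omega
    · split_ifs <;> omega
    · split_ifs <;> omega
  · rintro ⟨g, hg⟩
    have hc := hg.compatible
    simp only [patternVec, textVec, compatible_map_append] at hc
    obtain ⟨i, hi, hgi⟩ := exists_index_mod_three (g := g) (n := 2 ^ h + 1)
      (by have := (hc 0 (by omega)).2.1
          rcases this with this | this <;> split_ifs at this <;> omega)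
      (by have := (hc (2 ^ h + 1) (by omega)).2.2
          rcases this with this | this <;> split_ifs at this <;> omega) hg.step
    have hci := (hc i (by omega)).1
    simp only [hgi, if_true] at hci
    -- Multiplication by `2 ^ h` moves the bits of the upper assignment to the positions of its
    -- variables.
    refine ⟨fun x => if (x : ℕ) < h then i.testBit x else (g i / 3 * 2 ^ h).testBit x,
      fun cl hcl => ?_⟩
    have h1 := hci _ (List.mem_map_of_mem hcl)
    have hle := clauseVal_le h (g i / 3 * 2 ^ h) 0 (cl.map fun l => 2 * (l.1 : ℕ) + l.2.toNat)
    have h2 : clauseVal h i 1 (cl.map fun l => 2 * (l.1 : ℕ) + l.2.toNat) = 1 ∨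
        clauseVal h (g i / 3 * 2 ^ h) 0 (cl.map fun l => 2 * (l.1 : ℕ) + l.2.toNat) = 1 := by
      rcases h1 with h1 | h1 <;> split_ifs at h1 <;> omega
    simp only [clauseVal_eq_one, List.mem_map] at h2
    rcases h2 with ⟨_, ⟨l, hl, rfl⟩, h3⟩ | ⟨_, ⟨l, hl, rfl⟩, h3⟩
    · obtain ⟨h4, h5⟩ := (litVal_eq_one l).1 h3
      refine ⟨l, hl, ?_⟩
      have hlt : (l.1 : ℕ) < h := by by_contra hlt; simp [hlt] at h5
      simp only [hlt, if_true, h4]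
    · obtain ⟨h4, h5⟩ := (litVal_eq_one l).1 h3
      refine ⟨l, hl, ?_⟩
      have hlt : ¬ (l.1 : ℕ) < h := by intro hlt; simp [hlt] at h5
      simp only [hlt, if_false, h4]

namespace Regexp

/-! ### The two expressions -/

/-- Words of the pattern have a single 4, at the end. Hence the other words of the second expression
(empty, or with several 4s) do no harm. -/
theorem eq_of_mem_pattern {va : ℕ → List ℕ} (hva : ∀ i, ∀ v ∈ va i, v ≤ 1) {n E K : ℕ} {w : List ℕ}
    (hw : w ∈ (cat (pattern va n E K)).lang) : ∃ u, w = u ++ [4] ∧ 4 ∉ u := by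
  rw [lang_cat, pattern] at hw
  obtain ⟨u1, h1, v, hv, rfl⟩ := mem_seqLang_append.1 hw
  obtain ⟨u2, h2, v', hv', rfl⟩ := mem_seqLang_append.1 hv
  obtain ⟨u3, h3, e, he, rfl⟩ := mem_seqLang_append.1 hv'
  obtain ⟨e', he', rfl⟩ := mem_seqLang_letter.1 he
  rw [mem_seqLang_nil.1 he']
  have hf : ∀ {l : List ℕ} {k : ℕ} {u : List ℕ}, u ∈ seqLang (filler l k) → 4 ∉ l → 4 ∉ u :=
    fun h hl h4 => hl (mem_of_mem_seqLang_filler h h4)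
  have hvec : ∀ {vs : List ℕ}, (∀ v ∈ vs, v ≤ 1) → ∀ {u : List ℕ},
      u ∈ seqLang (vs.flatMap coordPattern) → 4 ∉ u := by
    intro vs
    induction vs with
    | nil => intro _ u hu; simp [mem_seqLang_nil.1 hu]
    | cons a vs ih =>
      intro hvs u hu
      obtain ⟨u, hu', w', hw', rfl⟩ := mem_seqLang_append.1 hu
      obtain ⟨p, v, hv, rfl⟩ := mem_seqLang_star.1 hu'
      obtain ⟨q, v', hv', rfl⟩ := mem_seqLang_star.1 hv
      obtain ⟨v'', hv'', rfl⟩ := mem_seqLang_letter.1 hv'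
      have := ih (fun v hv => hvs v (by simp [hv])) hw'
      have := hvs a (by simp)
      simp [mem_seqLang_nil.1 hv'', List.mem_replicate, *]
      omega
  have hblocks : 4 ∉ u2 := by
    clear hw hv hv' h1 h3
    induction n generalizing u2 with
    | zero => simp [mem_seqLang_nil.1 h2]
    | succ n ih =>
      obtain ⟨w, hw, c, hc, rfl⟩ := mem_seqLang_append.1 h2
      obtain ⟨w', hw', rfl⟩ := mem_seqLang_letter.1 hw
      obtain ⟨w1, hw1, w2, hw2, rfl⟩ := mem_seqLang_append.1 hw'
      obtain ⟨w3, hw3, rfl⟩ := mem_seqLang_letter.1 hw2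
      obtain ⟨w4, hw4, w5, hw5, rfl⟩ := mem_seqLang_append.1 hw3
      obtain ⟨k, w6, hw6, rfl⟩ := mem_seqLang_star.1 hw5
      have i1 := ih _ hc
      have i2 := hvec (hva n) hw1
      have i3 := hf hw4 (by simp)
      have i4 := hf hw6 (by simp)
      simp [i1, i2, i3, i4, List.mem_replicate]
  exact ⟨u1 ++ (u2 ++ u3), by simp, by simp [hf h1, hf h3, hblocks]⟩

/-- The expressions that occur in patterns. -/
def IsItem (N : ℕ) (e : Regexp) : Prop := ∃ a ≤ N, e = letter a ∨ e = star (letter a)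

theorem mem_down {α : Type*} {f : ℕ → List α} {n : ℕ} {a : α} :
    a ∈ down f n ↔ ∃ i < n, a ∈ f i := by
  induction n with
  | zero => simp [down]
  | succ n ih =>
    rw [down, List.mem_append, ih]
    constructor
    · rintro (h | ⟨i, hi, h⟩)
      exacts [⟨n, by omega, h⟩, ⟨i, by omega, h⟩]
    · rintro ⟨i, hi, h⟩
      rcases eq_or_ne i n with rfl | hne
      exacts [Or.inl h, Or.inr ⟨i, by omega, h⟩]

theorem isItem_of_mem_pattern {va : ℕ → List ℕ} (hva : ∀ i, ∀ v ∈ va i, v ≤ 1) {n E K : ℕ}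
    {e : Regexp} (he : e ∈ pattern va n E K) : IsItem 4 e := by
  have hf : ∀ {l : List ℕ} {k : ℕ} {e : Regexp}, e ∈ filler l k → (∀ a ∈ l, a ≤ 4) →
      IsItem 4 e := by
    intro l k e he hl
    obtain ⟨_, _, h⟩ := mem_down.1 he
    obtain ⟨a, ha, rfl⟩ := List.mem_map.1 h
    exact ⟨a, hl a ha, Or.inr rfl⟩
  simp only [pattern, List.mem_append, List.mem_singleton] at he
  rcases he with he | he | he | rfl
  · exact hf he (by simp)
  · obtain ⟨i, _, h⟩ := mem_down.1 he
    simp only [block, List.mem_append, List.mem_cons, List.mem_flatMap] at h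
    rcases h with rfl | ⟨v, hv, h⟩ | rfl | h | rfl | h
    · exact ⟨3, by norm_num, Or.inl rfl⟩
    · have := hva i v hv
      simp only [coordPattern, List.mem_cons, List.not_mem_nil, or_false] at h
      rcases h with rfl | rfl | rfl
      · exact ⟨0, by norm_num, Or.inr rfl⟩
      · exact ⟨v, by omega, Or.inr rfl⟩
      · exact ⟨2, by norm_num, Or.inl rfl⟩
    · exact ⟨3, by norm_num, Or.inl rfl⟩
    · exact hf h (by simp)
    · exact ⟨3, by norm_num, Or.inr rfl⟩
    · exact hf h (by simp)
  · exact hf he (by simp)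
  · exact ⟨4, le_rfl, Or.inl rfl⟩

theorem foldr_max_eq {l : List ℕ} {d : ℕ} (h : ∀ a ∈ l, a ≤ d) (h' : d ∈ l) :
    l.foldr max 0 = d := by
  refine le_antisymm ?_ ?_
  · clear h'
    induction l with
    | nil => simp
    | cons a l ih =>
      rw [List.foldr_cons]
      exact max_le (h a (by simp)) (ih fun b hb => h b (by simp [hb]))
  · clear h
    induction l with
    | nil => simp at h'
    | cons a l ih =>
      rw [List.foldr_cons]
      rcases List.mem_cons.1 h' with rfl | h'
      exacts [le_max_left _ _, (ih h').trans (le_max_right _ _)]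

/-- One starred child is required because the depth must be exactly 2. -/
theorem isHomogeneous_cat_items {N : ℕ} {es : List Regexp} (h : ∀ e ∈ es, IsItem N e) {a : ℕ}
    (ha : star (letter a) ∈ es) : (cat es).IsHomogeneous [RegOp.cat, RegOp.star] := by
  refine ⟨by simp, ?_, ?_⟩
  · simp only [HasShape]
    refine ⟨List.ne_nil_of_mem ha, fun e he => ?_⟩
    obtain ⟨a, _, rfl | rfl⟩ := h e he <;> simp [HasShape]
  · simp only [depth, List.length_cons, List.length_nil, Nat.add_right_cancel_iff]
    refine foldr_max_eq (fun d hd => ?_) ?_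
    · obtain ⟨e, he, rfl⟩ := List.mem_map.1 (by simpa using hd)
      obtain ⟨a, _, rfl | rfl⟩ := h e he <;> simp [depth]
    · have := List.mem_map_of_mem (f := depth) ha
      simpa [depth] using this

theorem size_cat_items {N : ℕ} {es : List Regexp} (h : ∀ e ∈ es, IsItem N e) :
    (cat es).size = es.length := by
  simp only [size]
  induction es with
  | nil => simp
  | cons e es ih =>
    have := ih fun e he => h e (by simp [he])
    obtain ⟨a, _, rfl | rfl⟩ := h e (by simp) <;> simp_all [size] <;> omega

theorem letters_cat_items {N : ℕ} {es : List Regexp} (h : ∀ e ∈ es, IsItem N e) :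
    ∀ x ∈ (cat es).letters, x ≤ N := by
  intro x hx
  simp only [letters] at hx
  obtain ⟨l, hl, hx⟩ := List.mem_flatten.1 hx
  obtain ⟨e, he, rfl⟩ := List.mem_map.1 (by simpa using hl)
  obtain ⟨a, ha, rfl | rfl⟩ := h e he <;> simp [letters] at hx <;> omega

/-- `B` is an expression of type `t` for a single word `w ++ [4]`, as far as words with a single,
final `4` are concerned; its code is given by `pre` and `mid`. -/
structure IsWordExpr (t : List RegOp) (pre mid : List ℕ) (w : List ℕ) (B : Regexp) : Prop where
  homogeneous : B.IsHomogeneous t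
  size : B.size = w.length + 1
  letters : B.letters = w ++ [4]
  encode : B.encode = pre ++ (w.length + 1) :: (w.flatMap (fun a => [0, a]) ++ (mid ++ [0, 4]))
  mem : w ++ [4] ∈ B.lang
  eq : ∀ u, 4 ∉ u → u ++ [4] ∈ B.lang → u ++ [4] = w ++ [4]

theorem seqLang_letters (w : List ℕ) : seqLang (w.map letter) = {w} := by
  ext u
  induction w generalizing u with
  | nil => exact mem_seqLang_nil
  | cons a w ih =>
    rw [List.map_cons, mem_seqLang_letter]
    constructor
    · rintro ⟨v, hv, rfl⟩
      rw [(ih v).1 hv]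
      rfl
    · intro h
      exact ⟨w, (ih w).2 rfl, h⟩

theorem mem_seqLang_letters_append {w u : List ℕ} {e : Regexp} :
    u ∈ seqLang (w.map letter ++ [e]) ↔ ∃ v ∈ e.lang, u = w ++ v := by
  rw [mem_seqLang_append, seqLang_letters]
  have he : seqLang [e] = e.lang := by simp [seqLang]
  rw [he]
  constructor
  · rintro ⟨_, rfl, v, hv, rfl⟩
    exact ⟨v, hv, rfl⟩
  · rintro ⟨v, hv, rfl⟩
    exact ⟨w, rfl, v, hv, rfl⟩

theorem shape_letters (w : List ℕ) (t : List RegOp) : ∀ e ∈ w.map letter, HasShape t e := by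
  intro e he
  obtain ⟨a, _, rfl⟩ := List.mem_map.1 he
  cases t <;> simp [HasShape]

theorem map_letters_sum (w : List ℕ) : ((w.map letter).map size).sum = w.length := by
  induction w with
  | nil => rfl
  | cons a w ih => simp only [List.map_cons, List.sum_cons, ih, size, List.length_cons]; omega

theorem map_letters_flatten (w : List ℕ) : ((w.map letter).map letters).flatten = w := by
  induction w with
  | nil => rfl
  | cons a w ih => simpa [letters] using ih

theorem map_letters_encode (w : List ℕ) :
    ((w.map letter).map encode).flatten = w.flatMap fun a => [0, a] := by
  induction w with
  | nil => rfl
  | cons a w ih => simpa [encode] using ih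

theorem depth_cat_letters_append {w : List ℕ} {e : Regexp} :
    (cat (w.map letter ++ [e])).depth = e.depth + 1 := by
  simp only [depth, Nat.add_right_cancel_iff]
  refine foldr_max_eq (fun d hd => ?_) (by simp)
  obtain ⟨f, hf, rfl⟩ := List.mem_map.1 hd
  rcases List.mem_append.1 hf with hf | hf
  · obtain ⟨a, _, rfl⟩ := List.mem_map.1 hf
    simp [depth]
  · simp at hf
    rw [hf]

/-- For the types that start with `∘`, the inner operator is applied to the final 4 only. Words are
`w` followed by 4s, and a single final 4 leaves just `w ++ [4]`. -/
theorem isWordExpr_cat {op : RegOp} {mid w : List ℕ} {e : Regexp} (hop : op ≠ RegOp.cat)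
    (hshape : HasShape [op] e) (hdepth : e.depth = 1) (hsize : e.size = 1)
    (hletters : e.letters = [4]) (hencode : e.encode = mid ++ [0, 4]) (hmem : [4] ∈ e.lang)
    (hlang : ∀ u ∈ e.lang, ∀ b ∈ u, b = 4) (hw : 4 ∉ w) :
    IsWordExpr [RegOp.cat, op] [1] mid w (cat (w.map letter ++ [e])) where
  homogeneous := by
    refine ⟨by simpa using hop.symm, ?_, by rw [depth_cat_letters_append, hdepth]; rfl⟩
    simp only [HasShape]
    refine ⟨by simp, fun f hf => ?_⟩
    rcases List.mem_append.1 hf with hf | hf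
    · exact shape_letters w _ f hf
    · rw [List.mem_singleton.1 hf]; exact hshape
  size := by simp only [size, List.map_append, List.sum_append, map_letters_sum]; simp [hsize]
  letters := by
    simp only [letters, List.map_append, List.flatten_append, map_letters_flatten]
    simp [hletters]
  encode := by
    simp only [encode, List.map_append, List.flatten_append, map_letters_encode]
    simp [hencode]
  mem := by
    rw [lang_cat, mem_seqLang_letters_append]
    exact ⟨[4], hmem, rfl⟩
  eq := by
    intro u hu h
    rw [lang_cat, mem_seqLang_letters_append] at h
    obtain ⟨v, hv, h⟩ := h
    rcases List.append_eq_append_iff.1 h with ⟨c, h1, h2⟩ | ⟨c, h1, h2⟩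
    · match c with
      | [] => simpa using h1.symm
      | b :: c =>
        simp only [List.cons_append, List.cons.injEq, List.nil_eq, List.append_eq_nil_iff] at h2
        exact absurd (by rw [h1, ← h2.1]; simp) hw
    · match c with
      | [] => simpa using h1
      | b :: c =>
        have hb := hlang v hv b (by rw [h2]; simp)
        exact absurd (by rw [h1, hb]; simp) hu

theorem depth_cat_letters (w : List ℕ) (a : ℕ) : (cat (w.map letter ++ [letter a])).depth = 1 := by
  rw [depth_cat_letters_append]
  simp [depth]

theorem lang_cat_letters (w : List ℕ) (a : ℕ) :
    (cat (w.map letter ++ [letter a])).lang = {w ++ [a]} := by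
  rw [lang_cat, ← seqLang_letters, List.map_append]
  rfl

/-- For the types that end with `∘`, the operator is applied to the whole word. Every nonempty word
starts with `w ++ [4]`, so a word whose first 4 is its last letter equals `w ++ [4]`. -/
theorem isWordExpr_of_cat_letters {op : RegOp} {pre w : List ℕ} {e : Regexp} (hop : op ≠ RegOp.cat)
    (hshape : ∀ t, HasShape t (cat (w.map letter ++ [letter 4])) → HasShape (op :: t) e)
    (hdepth : e.depth = (cat (w.map letter ++ [letter 4])).depth + 1)
    (hsize : e.size = (cat (w.map letter ++ [letter 4])).size)
    (hletters : e.letters = (cat (w.map letter ++ [letter 4])).letters)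
    (hencode : e.encode = pre ++ (cat (w.map letter ++ [letter 4])).encode)
    (hmem : w ++ [4] ∈ e.lang)
    (hlang : ∀ u ∈ e.lang, u = [] ∨ ∃ v, u = w ++ 4 :: v) (hw : 4 ∉ w) :
    IsWordExpr [op, RegOp.cat] (pre ++ [1]) [] w e where
  homogeneous := by
    refine ⟨by simpa using hop, hshape _ ?_, by rw [hdepth, depth_cat_letters]; rfl⟩
    simp only [HasShape]
    refine ⟨by simp, fun f hf => ?_⟩
    rcases List.mem_append.1 hf with hf | hf
    · exact shape_letters w _ f hf
    · rw [List.mem_singleton.1 hf]; simp [HasShape]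
  size := by
    rw [hsize]
    simp only [size, List.map_append, List.sum_append, map_letters_sum]; simp [size]
  letters := by
    rw [hletters]
    simp only [letters, List.map_append, List.flatten_append, map_letters_flatten]
    simp [letters]
  encode := by
    rw [hencode]
    simp only [encode, List.map_append, List.flatten_append, map_letters_encode]
    simp [encode]
  mem := hmem
  eq := by
    intro u hu h
    rcases hlang _ h with h | ⟨v, h⟩
    · simp at h
    · rcases List.append_eq_append_iff.1 h with ⟨c, h1, h2⟩ | ⟨c, h1, h2⟩
      · match c with
        | [] => simpa using h1.symm
        | b :: c =>
          simp only [List.cons_append, List.cons.injEq, List.nil_eq, List.append_eq_nil_iff] at h2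
          exact absurd (by rw [h1, ← h2.1]; simp) hw
      · match c with
        | [] => simpa using h1
        | b :: c =>
          rw [List.cons_append, List.cons.injEq] at h2
          exact absurd (by rw [h1, ← h2.1]; simp) hu

theorem exists_isWordExpr {t : List RegOp}
    (ht : t ∈ [[RegOp.cat, RegOp.star], [RegOp.cat, RegOp.alt], [RegOp.cat, RegOp.plus],
      [RegOp.alt, RegOp.cat], [RegOp.plus, RegOp.cat], [RegOp.star, RegOp.cat]]) :
    ∃ pre mid : List ℕ, (∀ v ∈ pre ++ mid, v ≤ 4) ∧ pre.length + mid.length ≤ 3 ∧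
      ∀ w : List ℕ, 4 ∉ w → ∃ B, IsWordExpr t pre mid w B := by
  have hkstar : ∀ {w u : List ℕ}, u ∈ KStar.kstar ({w ++ [4]} : Language ℕ) →
      u = [] ∨ ∃ v, u = w ++ 4 :: v := by
    intro w u hu
    obtain ⟨L, rfl, hL⟩ := Language.mem_kstar.1 hu
    match L with
    | [] => exact Or.inl rfl
    | y :: L =>
      rw [hL y (by simp)]
      exact Or.inr ⟨L.flatten, by simp⟩
  have hself : ∀ w : List ℕ, w ∈ KStar.kstar ({w} : Language ℕ) := fun w =>
    Language.mem_kstar.2 ⟨[w], by simp, by rintro y hy; rw [List.mem_singleton.1 hy]; rfl⟩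
  have hall : ∀ u ∈ (star (letter 4)).lang, ∀ b ∈ u, b = 4 := by
    intro u hu b hb
    obtain ⟨k, rfl⟩ := mem_lang_star_letter.1 hu
    exact (List.mem_replicate.1 hb).2
  have hplus : ∀ e : Regexp, ∀ u, u ∈ (plus e).lang ↔
      ∃ a ∈ e.lang, ∃ b ∈ KStar.kstar e.lang, a ++ b = u := by
    intro e u
    rw [lang, Language.mem_mul]
  have hstar : ∀ e : Regexp, (star e).lang = KStar.kstar e.lang := fun e => by rw [lang]
  have halt : ∀ e : Regexp, (alt [e]).lang = e.lang := fun e => by simp [lang]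
  have eqs : ∀ e : Regexp, ((plus e).depth = e.depth + 1 ∧ (plus e).size = e.size ∧
      (plus e).letters = e.letters ∧ (plus e).encode = 3 :: e.encode) ∧
      (star e).depth = e.depth + 1 ∧ (star e).size = e.size ∧
      (star e).letters = e.letters ∧ (star e).encode = 4 :: e.encode := fun e => by
    simp [depth, size, letters, encode]
  simp only [List.mem_cons, List.not_mem_nil, or_false] at ht
  rcases ht with rfl | rfl | rfl | rfl | rfl | rfl
  · refine ⟨[1], [4], by simp, by simp, fun w hw => ⟨_, isWordExpr_cat (e := star (letter 4))
      (by simp) (by simp [HasShape]) (by simp [depth]) (by simp [size]) (by simp [letters])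
      (by simp [encode]) (mem_lang_star_letter.2 ⟨1, rfl⟩) hall hw⟩⟩
  · refine ⟨[1], [2, 1], by simp, by simp, fun w hw => ⟨_, isWordExpr_cat (e := alt [letter 4])
      (by simp) (by simp [HasShape]) (by simp [depth]) (by simp [size]) (by simp [letters])
      (by simp [encode]) (by simp [lang]; rfl) (fun u hu b hb => ?_) hw⟩⟩
    have hu' : u ∈ ({[4]} : Language ℕ) := by simpa [lang] using hu
    rw [Set.mem_singleton_iff.1 hu'] at hb
    simpa using hb
  · refine ⟨[1], [3], by simp, by simp, fun w hw => ⟨_, isWordExpr_cat (e := plus (letter 4))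
      (by simp) (by simp [HasShape]) (by simp [depth]) (by simp [size]) (by simp [letters])
      (by simp [encode]) ?_ (fun u hu b hb => ?_) hw⟩⟩
    · exact (hplus _ _).2 ⟨[4], by rw [lang]; rfl, [], Language.nil_mem_kstar _, rfl⟩
    · rw [hplus, ← hstar] at hu
      obtain ⟨x, hx, y, hy, rfl⟩ := hu
      rw [lang] at hx
      rcases List.mem_append.1 hb with h | h
      · rw [Set.mem_singleton_iff.1 hx] at h; simpa using h
      · exact hall y hy b h
  · refine ⟨[2, 1] ++ [1], [], by simp, by simp, fun w hw => ⟨_, isWordExpr_of_cat_letters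
      (e := alt [cat (w.map letter ++ [letter 4])])
      (by simp) (fun t h => by simpa [HasShape] using h) (by simp [depth]) (by simp [size])
      (by simp [letters]) (by simp [encode]) ?_ (fun u hu => ?_) hw⟩⟩
    · rw [halt, lang_cat_letters]; rfl
    · rw [halt, lang_cat_letters] at hu
      exact Or.inr ⟨[], hu⟩
  · refine ⟨[3] ++ [1], [], by simp, by simp, fun w hw => ⟨_, isWordExpr_of_cat_letters
      (e := plus (cat (w.map letter ++ [letter 4])))
      (by simp) (fun t h => by simpa only [HasShape] using h) (eqs _).1.1 (eqs _).1.2.1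
      (eqs _).1.2.2.1 (eqs _).1.2.2.2 ?_ (fun u hu => ?_) hw⟩⟩
    · rw [hplus, lang_cat_letters]
      exact ⟨_, rfl, [], Language.nil_mem_kstar _, List.append_nil _⟩
    · rw [hplus, lang_cat_letters] at hu
      obtain ⟨x, rfl, y, _, rfl⟩ := hu
      exact Or.inr ⟨y, by simp⟩
  · refine ⟨[4] ++ [1], [], by simp, by simp, fun w hw => ⟨_, isWordExpr_of_cat_letters
      (e := star (cat (w.map letter ++ [letter 4])))
      (by simp) (fun t h => by simpa only [HasShape] using h) (eqs _).2.1 (eqs _).2.2.1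
      (eqs _).2.2.2.1 (eqs _).2.2.2.2 ?_ (fun u hu => ?_) hw⟩⟩
    · rw [hstar, lang_cat_letters]
      exact hself _
    · rw [hstar, lang_cat_letters] at hu
      exact hkstar hu

end Regexp

namespace WordRAM

open Prog

/-! ### The program that writes the two expressions -/

/-- The contents of the global registers. -/
def globals (L n d h M : ℕ) : List ℕ :=
  [L, 1, 0, 2, 3, 4, 8, 9, 15, n, d, n + 1, h, M, d + 2, (d + 2) * 2, 9 * M, (d + 2) * 2 + 1,
    9 * M * ((d + 2) * 2 + 1), 15 * (d + 2), 3 + 15 * (d + 2), M + 2,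
    (M + 2) * (3 + 15 * (d + 2)), 8 * (9 * M * ((d + 2) * 2 + 1)),
    (M + 2) * (3 + 15 * (d + 2)) + 8 * (9 * M * ((d + 2) * 2 + 1)),
    (M + 2) * (3 + 15 * (d + 2)) + 8 * (9 * M * ((d + 2) * 2 + 1)) + 1,
    9 * M * ((d + 2) * 2 + 1) + 1, M + 1]

/-- Compute the global registers. -/
def setup : Prog :=
  seq (const 2 1) <| seq (const 3 0) <| seq (const 4 2) <| seq (const 5 3) <| seq (const 6 4) <|
  seq (const 7 8) <| seq (const 8 9) <| seq (const 9 15) <|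
  seq (load 10 3) <| seq (load 11 2) <|
  seq (op .add 12 10 2) <| seq (op .div 13 12 4) <| seq (op .shl 14 2 13) <|
  seq (op .add 15 11 4) <| seq (op .mul 16 15 4) <| seq (op .mul 17 8 14) <|
  seq (op .add 18 16 2) <| seq (op .mul 19 17 18) <| seq (op .mul 20 9 15) <|
  seq (op .add 21 5 20) <| seq (op .add 22 14 4) <| seq (op .mul 23 22 21) <|
  seq (op .mul 24 7 19) <| seq (op .add 25 23 24) <| seq (op .add 26 25 2) <|
  seq (op .add 27 19 2) <| seq (op .add 28 14 2) skip

theorem Runs.conv {W : ℕ} {x Γ Γ' Γ'' : List ℕ} {p : Prog} {T : ℕ} {f f' : List ℕ}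
    (h : Runs W x Γ p T Γ' f) (hΓ : Γ' = Γ'') (hf : f = f') : Runs W x Γ p T Γ'' f' := by
  subst hΓ hf
  exact h

/-- These rules execute the first instruction of a sequence symbolically. The environment remains an
explicit list, so that register lookups hold by `rfl`. -/
theorem Runs.constThen {W : ℕ} {x Γ Γ' : List ℕ} {q : Prog} {T : ℕ} {f : List ℕ} {r k : ℕ}
    (hk : k < W) (hr : r = Γ.length + 1) (hΓ : Γ.length < 63)
    (h : Runs W x (Γ ++ [k]) q T Γ' f) : Runs W x Γ (Prog.seq (Prog.const r k) q) (T + 1) Γ' f :=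
  ((Runs.const k hk r hr hΓ).seq h).mono (by omega)

theorem Runs.loadThen {W : ℕ} {x Γ Γ' : List ℕ} {q : Prog} {T : ℕ} {f : List ℕ} {r j a : ℕ} (v : ℕ)
    (hj : Γ[j]? = some a) (hv : x[a]? = some v) (hr : r = Γ.length + 1) (hΓ : Γ.length < 63)
    (h : Runs W x (Γ ++ [v]) q T Γ' f) : Runs W x Γ (Prog.seq (Prog.load r (j + 1)) q) (T + 1) Γ' f :=
  ((Runs.load r j hj hv hr hΓ).seq h).mono (by omega)

theorem Runs.opThen {W : ℕ} {x Γ Γ' : List ℕ} {q : Prog} {T : ℕ} {f : List ℕ} {o : BinOp}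
    {r i j a b : ℕ} (v : ℕ) (hi : Γ[i]? = some a) (hj : Γ[j]? = some b) (hv : o.eval a b = v)
    (hW : v < W) (hr : r = Γ.length + 1) (hΓ : Γ.length < 63)
    (h : Runs W x (Γ ++ [v]) q T Γ' f) : Runs W x Γ (Prog.seq (Prog.op o r (i + 1) (j + 1)) q) (T + 1) Γ' f := by
  subst hv
  exact ((Runs.op o r i j hi hj hr hΓ hW).seq h).mono (by omega)

theorem Runs.updateThen {W : ℕ} {x Γ Γ' : List ℕ} {q : Prog} {T : ℕ} {f : List ℕ} {o : BinOp}
    {r i j a b : ℕ} (v : ℕ) (hi : Γ[i]? = some a) (hj : Γ[j]? = some b) (hv : o.eval a b = v)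
    (hW : v < W) (hr : r < 63) (h : Runs W x (Γ.set r v) q T Γ' f) :
    Runs W x Γ (Prog.seq (Prog.op o (r + 1) (i + 1) (j + 1)) q) (T + 1) Γ' f := by
  subst hv
  exact ((Runs.update o r i j hi hj hr hW).seq h).mono (by omega)

theorem Runs.skip' {W : ℕ} {x Γ Γ' Γ'' : List ℕ} (h : Γ = Γ' ++ Γ'') :
    Runs W x Γ Prog.skip 1 Γ' [] := by
  subst h
  exact Runs.weaken Runs.skip

theorem runs_setup {W n d h M : ℕ} {x : List ℕ} (h0 : x[0]? = some n) (h1 : x[1]? = some d)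
    (hh : (n + 1) / 2 = h) (hM : 1 <<< h = M) (hW : ∀ v ∈ globals x.length n d h M, v < W) :
    Runs W x [x.length] setup 28 (globals x.length n d h M) [] := by
  simp only [globals, List.mem_cons, forall_eq_or_imp, List.not_mem_nil, false_implies,
    implies_true, and_true] at hW
  obtain ⟨_, w1, w2, w3, w4, w5, w6, w7, w8, w9, w10, w11, w12, w13, w14, w15, w16, w17, w18, w19,
    w20, w21, w22, w23, w24, w25, w26, w27⟩ := hW
  unfold setup
  refine Runs.constThen w1 rfl (by simp) ?_
  simp only [List.cons_append, List.nil_append]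
  refine Runs.constThen w2 rfl (by simp) ?_
  simp only [List.cons_append, List.nil_append]
  refine Runs.constThen w3 rfl (by simp) ?_
  simp only [List.cons_append, List.nil_append]
  refine Runs.constThen w4 rfl (by simp) ?_
  simp only [List.cons_append, List.nil_append]
  refine Runs.constThen w5 rfl (by simp) ?_
  simp only [List.cons_append, List.nil_append]
  refine Runs.constThen w6 rfl (by simp) ?_
  simp only [List.cons_append, List.nil_append]
  refine Runs.constThen w7 rfl (by simp) ?_
  simp only [List.cons_append, List.nil_append]
  refine Runs.constThen w8 rfl (by simp) ?_
  simp only [List.cons_append, List.nil_append]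
  refine Runs.loadThen n rfl h0 rfl (by simp) ?_
  simp only [List.cons_append, List.nil_append]
  refine Runs.loadThen d rfl h1 rfl (by simp) ?_
  simp only [List.cons_append, List.nil_append]
  refine Runs.opThen (n + 1) rfl rfl rfl w11 rfl (by simp) ?_
  simp only [List.cons_append, List.nil_append]
  refine Runs.opThen h rfl rfl hh w12 rfl (by simp) ?_
  simp only [List.cons_append, List.nil_append]
  refine Runs.opThen M rfl rfl hM w13 rfl (by simp) ?_
  simp only [List.cons_append, List.nil_append]
  refine Runs.opThen (d + 2) rfl rfl rfl w14 rfl (by simp) ?_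
  simp only [List.cons_append, List.nil_append]
  refine Runs.opThen ((d + 2) * 2) rfl rfl rfl w15 rfl (by simp) ?_
  simp only [List.cons_append, List.nil_append]
  refine Runs.opThen (9 * M) rfl rfl rfl w16 rfl (by simp) ?_
  simp only [List.cons_append, List.nil_append]
  refine Runs.opThen ((d + 2) * 2 + 1) rfl rfl rfl w17 rfl (by simp) ?_
  simp only [List.cons_append, List.nil_append]
  refine Runs.opThen (9 * M * ((d + 2) * 2 + 1)) rfl rfl rfl w18 rfl (by simp) ?_
  simp only [List.cons_append, List.nil_append]
  refine Runs.opThen (15 * (d + 2)) rfl rfl rfl w19 rfl (by simp) ?_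
  simp only [List.cons_append, List.nil_append]
  refine Runs.opThen (3 + 15 * (d + 2)) rfl rfl rfl w20 rfl (by simp) ?_
  simp only [List.cons_append, List.nil_append]
  refine Runs.opThen (M + 2) rfl rfl rfl w21 rfl (by simp) ?_
  simp only [List.cons_append, List.nil_append]
  refine Runs.opThen ((M + 2) * (3 + 15 * (d + 2))) rfl rfl rfl w22 rfl (by simp) ?_
  simp only [List.cons_append, List.nil_append]
  refine Runs.opThen (8 * (9 * M * ((d + 2) * 2 + 1))) rfl rfl rfl w23 rfl (by simp) ?_
  simp only [List.cons_append, List.nil_append]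
  refine Runs.opThen ((M + 2) * (3 + 15 * (d + 2)) + 8 * (9 * M * ((d + 2) * 2 + 1))) rfl rfl rfl w24 rfl (by simp) ?_
  simp only [List.cons_append, List.nil_append]
  refine Runs.opThen ((M + 2) * (3 + 15 * (d + 2)) + 8 * (9 * M * ((d + 2) * 2 + 1)) + 1) rfl rfl rfl w25 rfl (by simp) ?_
  simp only [List.cons_append, List.nil_append]
  refine Runs.opThen (9 * M * ((d + 2) * 2 + 1) + 1) rfl rfl rfl w26 rfl (by simp) ?_
  simp only [List.cons_append, List.nil_append]
  refine Runs.opThen (M + 1) rfl rfl rfl w27 rfl (by simp) ?_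
  simp only [List.cons_append, List.nil_append]
  exact Runs.skip

/-- Append the contents of the registers `js` to the output as often as register `j` says;
register `r` is the counter. -/
def rep (r j : ℕ) (js : List ℕ) : Prog :=
  seq (op .add (r + 1) (j + 1) 3)
    (loop (r + 1) (seq (op .sub (r + 1) (r + 1) 2) (Prog.emits js)))

theorem runs_rep {W : ℕ} {x Γ : List ℕ} {r j N : ℕ} (js : List ℕ) {f : List ℕ}
    (hr : r = Γ.length) (hΓ : Γ.length < 63)
    (h1 : Γ[1]? = some 1) (h2 : Γ[2]? = some 0) (hj : Γ[j]? = some N)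
    (hf : js.map (fun j => Γ[j]?) = f.map some) (hN : N < W) :
    Runs W x Γ (rep r j js) (N * (2 * js.length + 3) + 2) Γ (down (fun _ => f) N) := by
  subst hr
  have hget : ∀ {i v n : ℕ}, Γ[i]? = some v → (Γ ++ [n])[i]? = some v := fun h => by
    rw [List.getElem?_append_left (List.getElem?_eq_some_iff.1 h).1, h]
  have hbody : ∀ n, n < N → Runs W x (Γ ++ [n + 1])
      (seq (op .sub (Γ.length + 1) (Γ.length + 1) 2) (Prog.emits js)) (1 + (2 * js.length + 1))
      (Γ ++ [n]) f := by
    intro n hn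
    refine Runs.seq (f := []) ((Runs.update .sub Γ.length Γ.length 1 (a := n + 1) (b := 1) (by simp)
      (hget h1) hΓ (by simp [BinOp.eval]; omega)).conv (Γ'' := Γ ++ [n]) ?_ rfl)
      (Runs.emits (hget h1) js ?_)
    · simp [BinOp.eval]
    · rw [← hf]
      refine List.map_congr_left fun j hj => ?_
      obtain ⟨v, _, hv⟩ := List.mem_map.1 (hf ▸ List.mem_map_of_mem (f := fun j => Γ[j]?) hj)
      rw [hget hv.symm, hv]
  have hloop := Runs.loopDown Γ.length N _ (fun n => Γ ++ [n]) (fun _ => f)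
    (fun n _ => by simp) hbody
  refine ((Runs.seq (f := []) (Runs.op .add _ j 2 hj h2 rfl hΓ hN) hloop).mono ?_).weaken
  rw [show 1 + (2 * js.length + 1) + 1 = 2 * js.length + 3 by ring]
  omega

/-- The registers in the loops over the vectors. -/
def vecEnv (L n d h M i ty I σ κ : ℕ) : List ℕ :=
  [L, 1, 0, 2, 3, 4, 8, 9, 15, n, d, n + 1, h, M, d + 2, (d + 2) * 2, 9 * M, (d + 2) * 2 + 1,
    9 * M * ((d + 2) * 2 + 1), 15 * (d + 2), 3 + 15 * (d + 2), M + 2,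
    (M + 2) * (3 + 15 * (d + 2)), 8 * (9 * M * ((d + 2) * 2 + 1)),
    (M + 2) * (3 + 15 * (d + 2)) + 8 * (9 * M * ((d + 2) * 2 + 1)),
    (M + 2) * (3 + 15 * (d + 2)) + 8 * (9 * M * ((d + 2) * 2 + 1)) + 1,
    9 * M * ((d + 2) * 2 + 1) + 1, M + 1, i, ty, I, σ, κ]

/-! ### Evaluation of the clauses -/

/-- Process one literal. -/
def literalBody : Prog :=
  seq (load 38 35) <| seq (op .div 39 38 4) <| seq (op .mod 40 38 4) <|
  seq (op .shr 41 31 39) <| seq (op .mod 42 41 4) <| seq (op .eq 43 42 40) <|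
  seq (op .lt 44 39 13) <| seq (op .eq 45 44 32) <| seq (op .mul 46 43 45) <|
  seq (op .or 37 37 46) <| seq (op .add 35 35 2) <| seq (op .sub 36 36 2) skip

section

variable {W L n d h M i ty I σ κ : ℕ} {x : List ℕ}

theorem runs_literalBody {r q len acc l : ℕ} (hL : x.length < W) (hx : ∀ v ∈ x, v < W)
    (hI : I < W) (h2 : 2 < W) (hl : x[q]? = some l) (hacc : acc ≤ 1) (hlen : len < W) :
    Runs W x (vecEnv L n d h M i ty I σ κ ++ [r, q, len + 1, acc]) literalBody 13
      (vecEnv L n d h M i ty I σ κ ++ [r, q + 1, len, acc ||| litVal h I σ l]) [] := by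
  obtain ⟨hq, hlx⟩ := List.getElem?_eq_some_iff.1 hl
  have hlW : l < W := hx l (hlx ▸ List.getElem_mem hq)
  have hbool : ∀ (P : Prop) [Decidable P], (if P then 1 else 0) ≤ 1 := fun P _ => by
    split_ifs <;> simp
  have hlv := litVal_le h I σ l
  have hor : acc ||| litVal h I σ l < W := by
    generalize litVal h I σ l = c at hlv
    interval_cases acc <;> interval_cases c <;> simp <;> omega
  unfold literalBody vecEnv
  simp only [List.cons_append, List.nil_append]
  refine Runs.loadThen l rfl hl rfl (by simp) ?_
  simp only [List.cons_append, List.nil_append]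
  refine Runs.opThen (l / 2) rfl rfl rfl ((Nat.div_le_self _ _).trans_lt hlW) rfl (by simp) ?_
  simp only [List.cons_append, List.nil_append]
  refine Runs.opThen (l % 2) rfl rfl rfl ((Nat.mod_le _ _).trans_lt hlW) rfl (by simp) ?_
  simp only [List.cons_append, List.nil_append]
  refine Runs.opThen (I >>> (l / 2)) rfl rfl rfl ((Nat.shiftRight_le _ _).trans_lt hI) rfl (by simp) ?_
  simp only [List.cons_append, List.nil_append]
  refine Runs.opThen ((I >>> (l / 2)) % 2) rfl rfl rfl ((Nat.mod_lt _ (by norm_num)).trans h2) rfl (by simp) ?_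
  simp only [List.cons_append, List.nil_append]
  refine Runs.opThen (if (I >>> (l / 2)) % 2 = l % 2 then 1 else 0) rfl rfl rfl
    ((hbool _).trans_lt (by omega)) rfl (by simp) ?_
  simp only [List.cons_append, List.nil_append]
  refine Runs.opThen (if l / 2 < h then 1 else 0) rfl rfl rfl
    ((hbool _).trans_lt (by omega)) rfl (by simp) ?_
  simp only [List.cons_append, List.nil_append]
  refine Runs.opThen (if (if l / 2 < h then 1 else 0) = σ then 1 else 0) rfl rfl rfl
    ((hbool _).trans_lt (by omega)) rfl (by simp) ?_
  simp only [List.cons_append, List.nil_append]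
  refine Runs.opThen (litVal h I σ l) rfl rfl rfl (hlv.trans_lt (by omega)) rfl (by simp) ?_
  simp only [List.cons_append, List.nil_append]
  refine Runs.updateThen (acc ||| litVal h I σ l) rfl rfl rfl hor (by simp) ?_
  simp only [List.set_cons_succ, List.set_cons_zero]
  refine Runs.updateThen (q + 1) rfl rfl rfl (by omega) (by simp) ?_
  simp only [List.set_cons_succ, List.set_cons_zero]
  refine Runs.updateThen len rfl rfl rfl (by omega) (by simp) ?_
  simp only [List.set_cons_succ, List.set_cons_zero]
  exact Runs.skip' rfl

end

end WordRAM

namespace WordRAM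

open Prog

theorem getElem?_of_drop_eq_cons {α : Type*} {x l : List α} {q : ℕ} {a : α}
    (h : x.drop q = a :: l) : x[q]? = some a ∧ x.drop (q + 1) = l := by
  constructor
  · have := congrArg (fun y => y[0]?) h
    simpa [List.getElem?_drop] using this
  · rw [← List.tail_drop, h, List.tail_cons]

/-- Process one clause, evaluating `o` on its value and on `κ`, and write the registers `js`. -/
def clauseBody (o : BinOp) (js : List ℕ) : Prog :=
  seq (load 36 35) <| seq (op .add 35 35 2) <| seq (op .add 37 3 3) <|
  seq (loop 36 literalBody) <| seq (op o 38 37 33) <| seq (Prog.emits js) <|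
  seq (op .sub 34 34 2) skip

/-- Process all clauses. -/
def clauseLoop (o : BinOp) (js : List ℕ) : Prog :=
  seq (op .add 34 11 3) <| seq (op .add 35 4 3) (loop 34 (clauseBody o js))

variable {W L n d h M i ty I σ κ : ℕ} {x : List ℕ}

theorem runs_literals (hL : x.length < W) (hx : ∀ v ∈ x, v < W) (hI : I < W) (h2 : 2 < W)
    {r q : ℕ} {l rest : List ℕ} (hl : x.drop q = l ++ rest) :
    Runs W x (vecEnv L n d h M i ty I σ κ ++ [r, q, l.length, 0]) (loop 36 literalBody)
      (l.length * 14 + 1)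
      (vecEnv L n d h M i ty I σ κ ++ [r, q + l.length, 0, clauseVal h I σ l]) [] := by
  have key := Runs.loopList (W := W) (x := x) (p := literalBody) (α := ℕ) (β := ℕ × ℕ) 35
    (fun l st => vecEnv L n d h M i ty I σ κ ++ [r, st.1, l.length, st.2])
    (fun st l => (st.1 + 1, st.2 ||| litVal h I σ l))
    (fun l st => x.drop st.1 = l ++ rest ∧ st.2 ≤ 1) (fun _ => []) (fun _ => 13)
    (fun l st _ => rfl)
    (fun a l st hst => ⟨(getElem?_of_drop_eq_cons hst.1).2,
      (foldl_or_litVal h I σ [a] hst.2).1⟩)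
    (fun a l st hst => by
      have hlen := congrArg List.length hst.1
      simp at hlen
      exact runs_literalBody hL hx hI h2 (getElem?_of_drop_eq_cons hst.1).1 hst.2 (by omega))
    l (q, 0) ⟨hl, by norm_num⟩
  have hfold : ∀ (l : List ℕ) (st : ℕ × ℕ),
      l.foldl (fun st l => (st.1 + 1, st.2 ||| litVal h I σ l)) st =
        (st.1 + l.length, l.foldl (fun acc l => acc ||| litVal h I σ l) st.2) := by
    intro l
    induction l with
    | nil => intro st; rfl
    | cons a l ih =>
      intro st
      rw [List.foldl_cons, ih]
      simp
      ring
  rw [hfold] at key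
  refine (key.conv rfl (by simp)).mono ?_
  simp

/-- One routine serves both sides. The pattern takes addition with `κ = 0`, which keeps the clause
value; the text takes `<` with `κ = 1` at genuine vectors, which negates it, and with `κ = 0` at
dummies, which gives 0. -/
theorem runs_clauseBody (hL : x.length < W) (hx : ∀ v ∈ x, v < W) (hI : I < W) (h2 : 2 < W)
    {o : BinOp} {js : List ℕ} {F : ℕ → List ℕ}
    (hF : ∀ a b c e v : ℕ, js.map (fun j => (vecEnv L n d h M i ty I σ κ ++ [a, b, c, e, v])[j]?) =
      (F v).map some)
    (ho : ∀ v, v ≤ 1 → o.eval v κ < W) {r q : ℕ} {l rest : List ℕ}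
    (hl : x.drop q = l.length :: (l ++ rest)) (hr : r < W) :
    Runs W x (vecEnv L n d h M i ty I σ κ ++ [r + 1, q]) (clauseBody o js)
      (14 * l.length + 2 * js.length + 8)
      (vecEnv L n d h M i ty I σ κ ++ [r, q + 1 + l.length])
      (F (o.eval (clauseVal h I σ l) κ)) := by
  obtain ⟨hq, hl'⟩ := getElem?_of_drop_eq_cons hl
  have hlen := congrArg List.length hl'
  simp at hlen
  have hqx := (List.getElem?_eq_some_iff.1 hq).1
  have hqx' : q + 1 ≤ x.length := hqx
  set v := o.eval (clauseVal h I σ l) κ with hv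
  have h1 : Runs W x (vecEnv L n d h M i ty I σ κ ++ [r + 1, q + 1 + l.length, 0,
      clauseVal h I σ l]) (seq (op o 38 37 33) <| seq (Prog.emits js) <|
      seq (op .sub 34 34 2) skip) (1 + ((2 * js.length + 1) + 2))
      (vecEnv L n d h M i ty I σ κ ++ [r, q + 1 + l.length]) (F v) := by
    refine (Runs.seq (Γ' := vecEnv L n d h M i ty I σ κ ++ [r + 1, q + 1 + l.length, 0,
      clauseVal h I σ l, v]) (f := []) ?_ (Runs.seq (Runs.emits rfl js (hF _ _ _ _ _)) (g := []) ?_)).conv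
      rfl (by simp)
    · exact Runs.op o _ 36 32 rfl rfl rfl (by simp [vecEnv]) (ho _ (clauseVal_le _ _ _ _))
    · unfold vecEnv
      simp only [List.cons_append, List.nil_append]
      refine Runs.updateThen r rfl rfl rfl hr (by simp) ?_
      simp only [List.set_cons_succ, List.set_cons_zero]
      exact Runs.skip' (Γ'' := [0, clauseVal h I σ l, v]) rfl
  have h3 := (runs_literals (n := n) (d := d) (M := M) (i := i) (ty := ty) (σ := σ) (κ := κ) (h := h)
    (L := L) (r := r + 1) hL hx hI h2 hl').seq h1
  refine Runs.mono (T := 14 * l.length + 1 + (1 + ((2 * js.length + 1) + 2)) + 1 + 1 + 1) ?_ (by omega)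
  unfold clauseBody
  refine Runs.loadThen (Γ := vecEnv L n d h M i ty I σ κ ++ [r + 1, q]) l.length rfl hq rfl
    (by simp [vecEnv]) ?_
  refine Runs.updateThen (Γ := vecEnv L n d h M i ty I σ κ ++ [r + 1, q, l.length]) (q + 1)
    rfl rfl rfl (by omega) (by simp) ?_
  refine Runs.opThen (Γ := vecEnv L n d h M i ty I σ κ ++ [r + 1, q + 1, l.length]) 0
    rfl rfl rfl (by omega) rfl (by simp [vecEnv]) ?_
  refine (h3.conv rfl rfl).mono (by omega) |>.conv ?_ (by simp)
  rfl

theorem runs_clauseLoop (hL : x.length < W) (hx : ∀ v ∈ x, v < W) (hI : I < W) (h2 : 2 < W)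
    {o : BinOp} {js : List ℕ} {F : ℕ → List ℕ}
    (hF : ∀ a b c e v : ℕ, js.map (fun j => (vecEnv L n d h M i ty I σ κ ++ [a, b, c, e, v])[j]?) =
      (F v).map some)
    (hjs : js.length ≤ 8) (ho : ∀ v, v ≤ 1 → o.eval v κ < W) {cls : List (List ℕ)}
    (hd : d = cls.length) (hcls : x.drop 2 = cls.flatMap fun cl => cl.length :: cl) :
    Runs W x (vecEnv L n d h M i ty I σ κ) (clauseLoop o js) (25 * x.length + 3)
      (vecEnv L n d h M i ty I σ κ)
      (cls.flatMap fun cl => F (o.eval (clauseVal h I σ cl) κ)) := by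
  have hflat : ∀ l : List (List ℕ), l.length ≤ (l.flatMap fun cl => cl.length :: cl).length := by
    intro l
    induction l with
    | nil => simp
    | cons a l ih => rw [List.flatMap_cons, List.length_append]; simp; omega
  have hlen := congrArg List.length hcls
  rw [List.length_drop] at hlen
  have hdx : d ≤ x.length := by
    have := hflat cls
    omega
  have key := Runs.loopList (W := W) (x := x) (p := clauseBody o js) (α := List ℕ) (β := ℕ) 33
    (fun l q => vecEnv L n d h M i ty I σ κ ++ [l.length, q])
    (fun q cl => q + 1 + cl.length)
    (fun l q => x.drop q = (l.flatMap fun cl => cl.length :: cl))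
    (fun cl => F (o.eval (clauseVal h I σ cl) κ)) (fun cl => 14 * cl.length + 2 * js.length + 8)
    (fun l st _ => rfl)
    (fun a l q hq => by
      rw [← List.drop_drop, ← List.drop_drop, hq]
      simp)
    (fun a l q hq => by
      have hlen' := congrArg List.length hq
      rw [List.length_drop, List.flatMap_cons, List.length_append] at hlen'
      have := hflat l
      exact runs_clauseBody hL hx hI h2 hF ho (rest := l.flatMap fun cl => cl.length :: cl)
        (by rw [hq]; simp) (by omega))
    cls 2 hcls
  -- A clause with `s` literals occupies `s + 1` cells and costs at most `14 s + 25` steps, as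
  -- `js.length ≤ 8`.
  have htime : ∀ l : List (List ℕ), (l.map fun cl => 14 * cl.length + 2 * js.length + 8 + 1).sum ≤
      25 * (l.flatMap fun cl => cl.length :: cl).length := by
    intro l
    induction l with
    | nil => simp
    | cons a l ih =>
      rw [List.flatMap_cons, List.length_append, List.map_cons, List.sum_cons]
      simp only [List.length_cons]
      omega
  have ht := htime cls
  subst hd
  refine Runs.mono (T := (cls.map fun cl => 14 * cl.length + 2 * js.length + 8 + 1).sum + 1 + 1 + 1)
    ?_ (by omega)
  unfold clauseLoop
  refine Runs.opThen (Γ := vecEnv L n cls.length h M i ty I σ κ) cls.length rfl rfl rfl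
    (by omega) rfl (by simp [vecEnv]) ?_
  refine Runs.opThen (Γ := vecEnv L n cls.length h M i ty I σ κ ++ [cls.length]) 2 rfl rfl rfl
    h2 rfl (by simp [vecEnv]) ?_
  exact Runs.weaken (key.conv (Γ'' := vecEnv L n cls.length h M i ty I σ κ ++ [0, _]) rfl rfl)

end WordRAM

/-! ### Writing the pattern -/

theorem flatMap_down {α β : Type*} (f : ℕ → List α) (g : α → List β) (n : ℕ) :
    (down f n).flatMap g = down (fun i => (f i).flatMap g) n := by
  induction n with
  | zero => rfl
  | succ n ih => rw [down, List.flatMap_append, ih]; rfl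

namespace Regexp

/-- The codes of a list of expressions. -/
def encodes (es : List Regexp) : List ℕ := es.flatMap encode

theorem encodes_append (es fs : List Regexp) : encodes (es ++ fs) = encodes es ++ encodes fs :=
  List.flatMap_append

theorem encodes_letter (a : ℕ) (es : List Regexp) :
    encodes (letter a :: es) = [0, a] ++ encodes es := by
  simp [encodes, encode]

theorem encodes_star (a : ℕ) (es : List Regexp) :
    encodes (star (letter a) :: es) = [4, 0, a] ++ encodes es := by
  simp [encodes, encode]

theorem encodes_nil : encodes [] = [] := rfl

theorem encodes_filler (l : List ℕ) (n : ℕ) :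
    encodes (filler l n) = down (fun _ => l.flatMap fun a => [4, 0, a]) n := by
  rw [encodes, filler, flatMap_down]
  congr
  funext _
  simp [List.flatMap_map, encode]

theorem encodes_coordPatterns (vs : List ℕ) :
    encodes (vs.flatMap coordPattern) = vs.flatMap fun v => [4, 0, 0, 4, 0, v, 0, 2] := by
  rw [encodes, List.flatMap_assoc]
  congr
  funext v
  simp [coordPattern, encode]

theorem encode_cat (es : List Regexp) : (cat es).encode = [1, es.length] ++ encodes es := by
  simp [encode, encodes, List.flatMap]

end Regexp

namespace WordRAM

open Prog

variable {W n d h M : ℕ} {x : List ℕ}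

/-- Write a vector of the pattern. -/
def patternVecProg : Prog :=
  seq (clauseLoop .add [5, 2, 2, 5, 2, 37, 2, 3]) <|
  seq (op .lt 34 3 29) <| seq (Prog.emits [5, 2, 2, 5, 2, 33, 2, 3]) <|
  seq (op .lt 35 29 28) (Prog.emits [5, 2, 2, 5, 2, 34, 2, 3])

theorem runs_patternVecProg (hL : x.length < W) (hx : ∀ v ∈ x, v < W) (h2 : 2 < W) {i : ℕ}
    (hi : i < W) {cls : List (List ℕ)} (hd : d = cls.length)
    (hcls : x.drop 2 = cls.flatMap fun cl => cl.length :: cl) (hM : M = 2 ^ h) :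
    Runs W x (vecEnv x.length n d h M i 0 i 1 0) patternVecProg (25 * x.length + 39)
      (vecEnv x.length n d h M i 0 i 1 0)
      ((patternVec h cls i).flatMap fun v => [4, 0, 0, 4, 0, v, 0, 2]) := by
  have hbool : ∀ (P : Prop) [Decidable P], (if P then 1 else 0) < W := fun P _ => by
    split_ifs <;> omega
  set v := (if 0 < i then 1 else 0) with hv
  set w := (if i < M + 1 then 1 else 0) with hw
  have h1 := runs_clauseLoop (n := n) (d := d) (M := M) (i := i) (ty := 0) (σ := 1) (κ := 0) (h := h)
    (L := x.length) (o := .add) (js := [5, 2, 2, 5, 2, 37, 2, 3])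
    (F := fun v => [4, 0, 0, 4, 0, v, 0, 2]) hL hx hi h2
    (fun a b c e v => rfl) (by simp) (fun v hv => by simp [BinOp.eval]; omega) hd hcls
  have h3 : Runs W x (vecEnv x.length n d h M i 0 i 1 0) (op .lt 34 3 29) 1
      (vecEnv x.length n d h M i 0 i 1 0 ++ [v]) [] :=
    Runs.op .lt 34 2 28 rfl rfl rfl (by simp [vecEnv]) (hbool _)
  have h4 : Runs W x (vecEnv x.length n d h M i 0 i 1 0 ++ [v])
      (Prog.emits [5, 2, 2, 5, 2, 33, 2, 3]) 17 (vecEnv x.length n d h M i 0 i 1 0 ++ [v])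
      [4, 0, 0, 4, 0, v, 0, 2] := Runs.emits rfl _ rfl
  have h5 : Runs W x (vecEnv x.length n d h M i 0 i 1 0 ++ [v]) (op .lt 35 29 28) 1
      (vecEnv x.length n d h M i 0 i 1 0 ++ [v] ++ [w]) [] :=
    Runs.op .lt 35 28 27 rfl rfl rfl (by simp [vecEnv]) (hbool _)
  have h6 : Runs W x (vecEnv x.length n d h M i 0 i 1 0 ++ [v] ++ [w])
      (Prog.emits [5, 2, 2, 5, 2, 34, 2, 3]) 17 (vecEnv x.length n d h M i 0 i 1 0 ++ [v] ++ [w])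
      [4, 0, 0, 4, 0, w, 0, 2] := Runs.emits rfl _ rfl
  have h7 := h1.seq (h3.seq (h4.seq (h5.seq h6)))
  rw [List.append_assoc (vecEnv _ _ _ _ _ _ _ _ _ _) [v] [w]] at h7
  refine (h7.weaken.conv rfl ?_).mono (by omega)
  rw [patternVec, ← hM, List.flatMap_append, List.flatMap_map]
  rfl

/-- Write a block of the pattern. -/
def patternBody : Prog :=
  seq (op .sub 29 29 2) <| seq (op .add 30 3 3) <| seq (op .add 31 29 3) <|
  seq (op .add 32 2 3) <| seq (op .add 33 3 3) <|
  seq (Prog.emits [2, 4]) <| seq patternVecProg <| seq (Prog.emits [2, 4]) <|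
  seq (rep 33 15 [5, 2, 2, 5, 2, 1, 5, 2, 3]) <| seq (Prog.emits [5, 2, 4]) <|
  rep 33 15 [5, 2, 2, 5, 2, 1, 5, 2, 3]

theorem runs_patternBody (hL : x.length < W) (hx : ∀ v ∈ x, v < W) (h2 : 2 < W) {i : ℕ}
    (hi : i < W) {cls : List (List ℕ)} (hd : d = cls.length)
    (hcls : x.drop 2 = cls.flatMap fun cl => cl.length :: cl) (hM : M = 2 ^ h)
    (hE : (d + 2) * 2 < W) :
    Runs W x (globals x.length n d h M ++ [i + 1]) patternBody (25 * x.length + 84 * (d + 2) + 65)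
      (globals x.length n d h M ++ [i])
      (Regexp.encodes (Regexp.block ((d + 2) * 2) (patternVec h cls i))) := by
  have h3 : Runs W x (vecEnv x.length n d h M i 0 i 1 0) (Prog.emits [2, 4]) 5
      (vecEnv x.length n d h M i 0 i 1 0) [0, 3] := Runs.emits rfl _ rfl
  have h4 : Runs W x (vecEnv x.length n d h M i 0 i 1 0) (Prog.emits [5, 2, 4]) 7
      (vecEnv x.length n d h M i 0 i 1 0) [4, 0, 3] := Runs.emits rfl _ rfl
  have h5 := runs_patternVecProg (n := n) hL hx h2 hi hd hcls hM
  have h6 : Runs W x (vecEnv x.length n d h M i 0 i 1 0)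
      (rep 33 15 [5, 2, 2, 5, 2, 1, 5, 2, 3]) ((d + 2) * 2 * 21 + 2)
      (vecEnv x.length n d h M i 0 i 1 0)
      (down (fun _ => [4, 0, 0, 4, 0, 1, 4, 0, 2]) ((d + 2) * 2)) :=
    runs_rep _ rfl (by simp [vecEnv]) rfl rfl rfl rfl hE
  have h7 := h3.seq (h5.seq (h3.seq (h6.seq (h4.seq h6))))
  refine Runs.mono (T := 5 + (25 * x.length + 39 +
    (5 + ((d + 2) * 2 * 21 + 2 + (7 + ((d + 2) * 2 * 21 + 2))))) + 1 + 1 + 1 + 1 + 1) ?_ (by omega)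
  unfold patternBody globals
  simp only [List.cons_append, List.nil_append]
  refine Runs.updateThen i rfl rfl rfl hi (by simp) ?_
  simp only [List.set_cons_succ, List.set_cons_zero]
  refine Runs.opThen 0 rfl rfl rfl (by omega) rfl (by simp) ?_
  simp only [List.cons_append, List.nil_append]
  refine Runs.opThen i rfl rfl rfl hi rfl (by simp) ?_
  simp only [List.cons_append, List.nil_append]
  refine Runs.opThen 1 rfl rfl rfl (by omega) rfl (by simp) ?_
  simp only [List.cons_append, List.nil_append]
  refine Runs.opThen 0 rfl rfl rfl (by omega) rfl (by simp) ?_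
  simp only [List.cons_append, List.nil_append]
  refine Runs.weaken (Γ'' := [0, i, 1, 0]) (h7.conv rfl ?_)
  simp only [Regexp.block, Regexp.encodes_letter, Regexp.encodes_append, Regexp.encodes_star,
    Regexp.encodes_filler, Regexp.encodes_coordPatterns]
  rfl

/-- Write the pattern. -/
def patternProg : Prog :=
  seq (Prog.emits [1, 25]) <| seq (rep 28 18 [5, 2, 2, 5, 2, 1, 5, 2, 3, 5, 2, 4]) <|
  seq (op .add 29 22 3) <| seq (loop 29 patternBody) <|
  seq (rep 28 18 [5, 2, 2, 5, 2, 1, 5, 2, 3, 5, 2, 4]) (Prog.emits [2, 5])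

theorem length_down {α : Type*} (f : ℕ → List α) (m : ℕ) (hf : ∀ i, (f i).length = m) (n : ℕ) :
    (down f n).length = n * m := by
  induction n with
  | zero => simp [down]
  | succ n ih => rw [down, List.length_append, hf, ih]; ring

/-- In the preorder code the number of children precedes the children, so the program needs a closed
formula for it. -/
theorem length_pattern {va : ℕ → List ℕ} {D : ℕ} (hD : ∀ i, (va i).length = D) (n E K : ℕ) :
    (Regexp.pattern va n E K).length = 8 * K + n * (3 + 3 * D + 6 * E) + 1 := by
  have hc : ∀ vs : List ℕ, (vs.flatMap Regexp.coordPattern).length = 3 * vs.length := by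
    intro vs
    induction vs with
    | nil => rfl
    | cons a vs ih =>
      rw [List.flatMap_cons, List.length_append, ih]
      simp [Regexp.coordPattern]
      omega
  have hf : ∀ (l : List ℕ) k, (Regexp.filler l k).length = k * l.length := fun l k =>
    length_down _ _ (fun _ => by simp) k
  rw [Regexp.pattern, List.length_append, List.length_append, List.length_append, hf,
    length_down _ (3 + 3 * D + 6 * E) (fun i => by simp [Regexp.block, hf, hc, hD]; ring)]
  simp
  ring

theorem runs_patternProg (hL : x.length < W) (hx : ∀ v ∈ x, v < W)
    {cls : List (List ℕ)} (hd : d = cls.length)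
    (hcls : x.drop 2 = cls.flatMap fun cl => cl.length :: cl) (hM : M = 2 ^ h)
    (hW : ∀ v ∈ globals x.length n d h M, v < W) :
    Runs W x (globals x.length n d h M) patternProg
      (54 * (9 * M * ((d + 2) * 2 + 1)) + (M + 2) * (25 * x.length + 84 * (d + 2) + 66) + 16)
      (globals x.length n d h M)
      (Regexp.cat (Regexp.pattern (patternVec h cls) (2 ^ h + 1 + 1) ((d + 2) * 2)
        (9 * M * ((d + 2) * 2 + 1)))).encode := by
  set G := globals x.length n d h M with hG
  set K := 9 * M * ((d + 2) * 2 + 1) with hK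
  set A := Regexp.pattern (patternVec h cls) (2 ^ h + 1 + 1) ((d + 2) * 2) K with hA
  have hlen : A.length = (M + 2) * (3 + 15 * (d + 2)) + 8 * K + 1 := by
    rw [hA, length_pattern (D := d + 2) (fun i => by rw [length_patternVec, hd]), hM]
    ring
  have h2 : 2 < W := hW 2 (by simp [hG, globals])
  have hE : (d + 2) * 2 < W := hW _ (by simp [hG, globals])
  have hMW : M + 2 < W := hW _ (by simp [hG, globals])
  have hKW : K < W := hW _ (by simp [hG, globals, hK])
  have h3 : Runs W x G (Prog.emits [1, 25]) 5 G [1, A.length] := by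
    rw [hlen]
    exact Runs.emits rfl _ rfl
  have h4 : Runs W x G (rep 28 18 [5, 2, 2, 5, 2, 1, 5, 2, 3, 5, 2, 4]) (K * 27 + 2) G
      (down (fun _ => [4, 0, 0, 4, 0, 1, 4, 0, 2, 4, 0, 3]) K) :=
    runs_rep _ rfl (by simp [hG, globals]) rfl rfl rfl rfl hKW
  have h5 : Runs W x G (op .add 29 22 3) 1 (G ++ [M + 2]) [] :=
    Runs.op .add 29 21 2 (a := M + 2) (b := 0) rfl rfl rfl (by simp [hG, globals]) hMW
  have h6 : Runs W x (G ++ [M + 2]) (loop 29 patternBody)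
      ((M + 2) * (25 * x.length + 84 * (d + 2) + 65 + 1) + 1) G
      (down (fun i => Regexp.encodes (Regexp.block ((d + 2) * 2) (patternVec h cls i))) (M + 2)) :=
    Runs.weaken (Runs.loopDown 28 (M + 2) _ (fun i => G ++ [i]) _ (fun i _ => rfl)
      fun i hi => runs_patternBody hL hx h2 (by omega) hd hcls hM hE)
  have h7 : Runs W x G (Prog.emits [2, 5]) 5 G [0, 4] := Runs.emits rfl _ rfl
  refine ((h3.seq (h4.seq (h5.seq (h6.seq (h4.seq h7))))).conv rfl ?_).mono ?_
  · rw [Regexp.encode_cat, hA, Regexp.pattern]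
    simp only [Regexp.encodes_letter, Regexp.encodes_append, Regexp.encodes_nil,
      Regexp.encodes_filler, hM]
    rw [show Regexp.encodes (down _ (2 ^ h + 1 + 1)) = _ from flatMap_down _ _ _]
    rfl
  · rw [show 25 * x.length + 84 * (d + 2) + 65 + 1 = 25 * x.length + 84 * (d + 2) + 66 by ring]
    omega

end WordRAM

/-! ### Writing the text -/

namespace WordRAM

open Prog

variable {W n d h M : ℕ} {x : List ℕ}

/-- Write a vector of the text. -/
def textVecProg : Prog :=
  seq (clauseLoop .lt [2, 37, 2, 3]) <|
  seq (op .lt 34 30 4) <| seq (Prog.emits [2, 33, 2, 3]) <|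
  seq (op .lt 35 3 30) (Prog.emits [2, 34, 2, 3])

theorem runs_textVecProg (hL : x.length < W) (hx : ∀ v ∈ x, v < W) (h2 : 2 < W) {g : ℕ}
    (hg : g / 3 * M < W) {cls : List (List ℕ)} (hd : d = cls.length)
    (hcls : x.drop 2 = cls.flatMap fun cl => cl.length :: cl) (hM : M = 2 ^ h) :
    Runs W x (vecEnv x.length n d h M g (g % 3) (g / 3 * M) 0 (if g % 3 = 1 then 1 else 0))
      textVecProg (25 * x.length + 23)
      (vecEnv x.length n d h M g (g % 3) (g / 3 * M) 0 (if g % 3 = 1 then 1 else 0))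
      ((textVec h cls g).flatMap fun v => [0, v, 0, 2]) := by
  have hbool : ∀ (P : Prop) [Decidable P], (if P then 1 else 0) < W := fun P _ => by
    split_ifs <;> omega
  set v := (if g % 3 < 2 then 1 else 0) with hv
  set w := (if 0 < g % 3 then 1 else 0) with hw
  set E := vecEnv x.length n d h M g (g % 3) (g / 3 * M) 0 (if g % 3 = 1 then 1 else 0) with hE
  have h1 : Runs W x E _ _ E _ := runs_clauseLoop (o := .lt) (js := [2, 37, 2, 3])
    (F := fun v => [0, v, 0, 2]) hL hx hg h2 (fun a b c e v => rfl) (by simp)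
    (fun v hv => hbool _) hd hcls
  have h3 : Runs W x E (op .lt 34 30 4) 1 (E ++ [v]) [] :=
    Runs.op .lt 34 29 3 rfl rfl rfl (by simp [hE, vecEnv]) (hbool _)
  have h4 : Runs W x (E ++ [v]) (Prog.emits [2, 33, 2, 3]) 9 (E ++ [v]) [0, v, 0, 2] :=
    Runs.emits rfl _ rfl
  have h5 : Runs W x (E ++ [v]) (op .lt 35 3 30) 1 (E ++ [v] ++ [w]) [] :=
    Runs.op .lt 35 2 29 rfl rfl rfl (by simp [hE, vecEnv]) (hbool _)
  have h6 : Runs W x (E ++ [v] ++ [w]) (Prog.emits [2, 34, 2, 3]) 9 (E ++ [v] ++ [w])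
      [0, w, 0, 2] := Runs.emits rfl _ rfl
  have h7 := h1.seq (h3.seq (h4.seq (h5.seq h6)))
  rw [List.append_assoc E [v] [w]] at h7
  refine (h7.weaken.conv rfl ?_).mono (by omega)
  rw [textVec, ← hM, List.flatMap_append, List.flatMap_map]
  rfl

/-- Write a block of the text. -/
def textBody : Prog :=
  seq (op .sub 29 29 2) <| seq (op .mod 30 29 5) <| seq (op .div 31 29 5) <|
  seq (op .add 32 3 3) <| seq (op .eq 33 30 2) <| seq (op .mul 31 31 14) <|
  seq (Prog.emits [2, 4]) textVecProg

theorem runs_textBody (hL : x.length < W) (hx : ∀ v ∈ x, v < W) (h2 : 2 < W) {g : ℕ}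
    (hgW : g < W) (hg : g / 3 * M < W) {cls : List (List ℕ)} (hd : d = cls.length)
    (hcls : x.drop 2 = cls.flatMap fun cl => cl.length :: cl) (hM : M = 2 ^ h) :
    Runs W x (globals x.length n d h M ++ [g + 1]) textBody (25 * x.length + 34)
      (globals x.length n d h M ++ [g])
      ((3 :: Regexp.vecText (textVec h cls g)).flatMap fun a => [0, a]) := by
  have h3 : Runs W x (vecEnv x.length n d h M g (g % 3) (g / 3 * M) 0
      (if g % 3 = 1 then 1 else 0)) (Prog.emits [2, 4]) 5
      (vecEnv x.length n d h M g (g % 3) (g / 3 * M) 0 (if g % 3 = 1 then 1 else 0)) [0, 3] :=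
    Runs.emits rfl _ rfl
  have h5 := h3.seq (runs_textVecProg (n := n) hL hx h2 hg hd hcls hM)
  refine Runs.mono (T := 5 + (25 * x.length + 23) + 1 + 1 + 1 + 1 + 1 + 1) ?_ (by omega)
  unfold textBody globals
  simp only [List.cons_append, List.nil_append]
  refine Runs.updateThen g rfl rfl rfl hgW (by simp) ?_
  simp only [List.set_cons_succ, List.set_cons_zero]
  refine Runs.opThen (g % 3) rfl rfl rfl ((Nat.mod_le _ _).trans_lt hgW) rfl (by simp) ?_
  simp only [List.cons_append, List.nil_append]
  refine Runs.opThen (g / 3) rfl rfl rfl ((Nat.div_le_self _ _).trans_lt hgW) rfl (by simp) ?_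
  simp only [List.cons_append, List.nil_append]
  refine Runs.opThen 0 rfl rfl rfl (by omega) rfl (by simp) ?_
  simp only [List.cons_append, List.nil_append]
  refine Runs.opThen (if g % 3 = 1 then 1 else 0) rfl rfl rfl (by split_ifs <;> omega) rfl
    (by simp) ?_
  simp only [List.cons_append, List.nil_append]
  refine Runs.updateThen (g / 3 * M) rfl rfl rfl hg (by simp) ?_
  simp only [List.set_cons_succ, List.set_cons_zero]
  refine Runs.weaken (Γ'' := [g % 3, g / 3 * M, 0, if g % 3 = 1 then 1 else 0]) (h5.conv rfl ?_)
  rw [List.flatMap_cons, Regexp.vecText, List.flatMap_assoc]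
  rfl

/-- The register holding a constant up to `4`. -/
def constReg (v : ℕ) : ℕ := [2, 1, 3, 4, 5].getD v 0

/-- Write the expression for the text. -/
def textProg (pre mid : List ℕ) : Prog :=
  seq (Prog.emits (pre.map constReg ++ [26])) <| seq (op .add 29 17 3) <|
  seq (loop 29 textBody) (Prog.emits (mid.map constReg ++ [2, 5]))

theorem runs_textProg (hL : x.length < W) (hx : ∀ v ∈ x, v < W)
    {cls : List (List ℕ)} (hd : d = cls.length)
    (hcls : x.drop 2 = cls.flatMap fun cl => cl.length :: cl) (hM : M = 2 ^ h)
    (hW : ∀ v ∈ globals x.length n d h M, v < W) (hMM : 3 * M * M < W) {pre mid : List ℕ}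
    (hle : ∀ v ∈ pre ++ mid, v ≤ 4) :
    Runs W x (globals x.length n d h M) (textProg pre mid)
      (9 * M * (25 * x.length + 35) + 2 * (pre.length + mid.length) + 10)
      (globals x.length n d h M)
      (pre ++ (9 * M * ((d + 2) * 2 + 1) + 1) ::
        ((Regexp.text (textVec h cls) (9 * M)).flatMap (fun a => [0, a]) ++ (mid ++ [0, 4]))) := by
  set G := globals x.length n d h M with hG
  have h2 : 2 < W := hW 2 (by simp [hG, globals])
  have hMW : 9 * M < W := hW _ (by simp [hG, globals])
  have hconst : ∀ l : List ℕ, (∀ v ∈ l, v ≤ 4) →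
      (l.map constReg).map (fun j => G[j]?) = l.map some := by
    intro l hl
    rw [List.map_map]
    refine List.map_congr_left fun v hv => ?_
    have := hl v hv
    interval_cases v <;> rfl
  have h3 : Runs W x G (Prog.emits (pre.map constReg ++ [26])) (2 * pre.length + 3) G
      (pre ++ [9 * M * ((d + 2) * 2 + 1) + 1]) := by
    refine (Runs.emits rfl _ ?_).mono (by simp; omega)
    rw [List.map_append, hconst _ (fun v hv => hle v (by simp [hv])), List.map_append]
    rfl
  have h5 : Runs W x G (op .add 29 17 3) 1 (G ++ [9 * M]) [] :=
    Runs.op .add 29 16 2 (a := 9 * M) (b := 0) rfl rfl rfl (by simp [hG, globals]) hMW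
  have h6 : Runs W x (G ++ [9 * M]) (loop 29 textBody) (9 * M * (25 * x.length + 34 + 1) + 1) G
      (down (fun g => (3 :: Regexp.vecText (textVec h cls g)).flatMap fun a => [0, a]) (9 * M)) :=
    Runs.weaken (Runs.loopDown 28 (9 * M) _ (fun g => G ++ [g]) _ (fun g _ => rfl)
      fun g hg => runs_textBody hL hx h2 (by omega)
        -- The shifted upper assignment `g / 3 * M` is the reason for the word bound on `3 * M * M`.
        (lt_of_le_of_lt (Nat.mul_le_mul_right M (by omega : g / 3 ≤ 3 * M)) hMM) hd hcls hM)
  have h7 : Runs W x G (Prog.emits (mid.map constReg ++ [2, 5])) (2 * mid.length + 5) G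
      (mid ++ [0, 4]) := by
    refine (Runs.emits rfl _ ?_).mono (by simp; omega)
    rw [List.map_append, hconst _ (fun v hv => hle v (by simp [hv])), List.map_append]
    rfl
  refine ((h3.seq (h5.seq (h6.seq h7))).conv rfl ?_).mono ?_
  · rw [Regexp.text, flatMap_down]
    simp
  · rw [show 25 * x.length + 34 + 1 = 25 * x.length + 35 by ring]
    omega

/-! ### Composition with the assumed algorithm -/

/-- Write both expressions behind the input. -/
def writeProg (pre mid : List ℕ) : Prog :=
  seq (op .add 1 0 2) <| seq setup <| seq patternProg (textProg pre mid)

/-- Write both expressions, and then run `p` on them. -/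
def reduction (pre mid : List ℕ) (p : Prog) : Prog :=
  seq (writeProg pre mid) <| seq (op .sub 64 0 1) <| seq p.relocate (op .or 0 64 64)

theorem holds_inputState (x : List ℕ) : Holds x [] [] (inputState x) where
  mem i := by simp [inputState]
  ptr := by simp [inputState]
  env i v hi := by simp at hi
  high r hr := by simp [inputState]; omega

/-- The output of the program `writeProg`. -/
def written (pre mid : List ℕ) (h d : ℕ) (cls : List (List ℕ)) : List ℕ :=
  (Regexp.cat (Regexp.pattern (patternVec h cls) (2 ^ h + 1 + 1) ((d + 2) * 2)
    (9 * 2 ^ h * ((d + 2) * 2 + 1)))).encode ++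
  (pre ++ (9 * 2 ^ h * ((d + 2) * 2 + 1) + 1) ::
    ((Regexp.text (textVec h cls) (9 * 2 ^ h)).flatMap (fun a => [0, a]) ++ (mid ++ [0, 4])))

theorem exec_writeProg {pre mid : List ℕ} {cls : List (List ℕ)} (hL : x.length < W)
    (hx : ∀ v ∈ x, v < W) (h0 : x[0]? = some n) (h1 : x[1]? = some d) (hd : d = cls.length)
    (hcls : x.drop 2 = cls.flatMap fun cl => cl.length :: cl) (hh : (n + 1) / 2 = h)
    (hW : ∀ v ∈ globals x.length n d h (2 ^ h), v < W) (hMM : 3 * 2 ^ h * 2 ^ h < W)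
    (hle : ∀ v ∈ pre ++ mid, v ≤ 4) (hlen : x.length + (written pre mid h d cls).length < W) :
    ∃ k s, k ≤ 54 * (9 * 2 ^ h * ((d + 2) * 2 + 1)) +
        (2 ^ h + 2) * (25 * x.length + 84 * (d + 2) + 66) +
        9 * 2 ^ h * (25 * x.length + 35) + 2 * (pre.length + mid.length) + 55 ∧
      Exec W (writeProg pre mid) (inputState x) k s ∧
      Holds x (globals x.length n d h (2 ^ h)) (written pre mid h d cls) s := by
  have hrun := (runs_setup h0 h1 hh (Nat.one_shiftLeft h) hW).seq
    ((runs_patternProg hL hx hd hcls rfl hW).seq (runs_textProg hL hx hd hcls rfl hW hMM hle))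
  -- Register 2 is still 0 here, so the addition copies the input length into register 1.
  have hadd : BinOp.eval .add ((inputState x).reg 0) ((inputState x).reg 2) = x.length := by
    simp [BinOp.eval, inputState]
  have hfirst : Holds x [x.length] [] ((inputState x).setReg 1 x.length) :=
    (holds_inputState x).setNew (by simp) x.length
  obtain ⟨k, s, hk, he, hs⟩ := hrun _ [] (by simpa [written] using hlen) hfirst
  refine ⟨1 + k, s, by omega, Exec.seq ?_ he, hs⟩
  have := Exec.op (W := W) (inputState x) .add 1 0 2 (by rw [hadd]; exact hL)
  rwa [hadd] at this

/-- Register 1 holds the input length, which is exactly the memory offset of the written output.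
With the output length in register 64, the state is a shifted initial state for `p`: the registers
above 64 and the memory behind the output are still 0. The final `or` copies the answer to register
0. -/
theorem decides_reduction {pre mid : List ℕ} {cls : List (List ℕ)} (hL : x.length < W)
    (hx : ∀ v ∈ x, v < W) (h0 : x[0]? = some n) (h1 : x[1]? = some d) (hd : d = cls.length)
    (hcls : x.drop 2 = cls.flatMap fun cl => cl.length :: cl) (hh : (n + 1) / 2 = h)
    (hW : ∀ v ∈ globals x.length n d h (2 ^ h), v < W) (hMM : 3 * 2 ^ h * 2 ^ h < W)
    (hle : ∀ v ∈ pre ++ mid, v ≤ 4) (hlen : x.length + (written pre mid h d cls).length < W)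
    {p : Prog} {V : ℕ} (hV : V + x.length ≤ W) {answer : Prop} {T : ℝ}
    (hp : DecidesWithin p V (written pre mid h d cls) answer T) :
    DecidesWithin (reduction pre mid p) W x answer
      ((54 * (9 * 2 ^ h * ((d + 2) * 2 + 1)) +
        (2 ^ h + 2) * (25 * x.length + 84 * (d + 2) + 66) +
        9 * 2 ^ h * (25 * x.length + 35) + 2 * (pre.length + mid.length) + 57 : ℕ) + 2 * T) := by
  obtain ⟨hpl, hpx, k', s', he', hk', hans⟩ := hp
  obtain ⟨k, s, hk, he, hs⟩ := exec_writeProg hL hx h0 h1 hd hcls hh hW hMM hle hlen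
  set out := written pre mid h d cls with hout
  have hs1 : s.reg 1 = x.length := hs.env 0 _ rfl
  have hsub : BinOp.eval .sub (s.reg 0) (s.reg 1) = out.length := by
    rw [hs1, hs.ptr]; simp [BinOp.eval]
  have hsim : Simulates x.length (inputState out) (s.setReg 64 out.length) := by
    refine ⟨fun r => ?_, fun i => ?_, ?_⟩
    · simp only [State.setReg, inputState, Function.update_apply, hs.high (r + 64) (by omega)]
      simp
    · simp only [State.setReg, inputState, hs.mem, List.getD_eq_getElem?_getD]
      rw [List.getElem?_append_right (by omega), Nat.add_sub_cancel]
    · simp [State.setReg, hs1]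
  have hbdd : (inputState out).Bounded V := by
    refine ⟨fun r => ?_, fun i => ?_⟩
    · simp only [inputState]
      split_ifs <;> omega
    · simp only [inputState]
      rw [List.getD_eq_getElem?_getD]
      rcases h : out[i]? with _ | v
      · simp; omega
      · exact hpx v (List.mem_of_getElem? h)
  obtain ⟨hbdd', k'', t, hk'', he'', ht⟩ := he'.relocate _ hbdd hsim
  refine ⟨hL, hx, k + (1 + (k'' + 1)), t.setReg 0 (t.reg 64 ||| t.reg 64), ?_, ?_, ?_⟩
  · refine Exec.seq he (Exec.seq ?_ (Exec.seq (he''.mono hV) (Exec.op t .or 0 64 64 ?_)))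
    · have := Exec.op (W := W) s .sub 64 0 1 (by rw [hsub]; omega)
      rwa [hsub] at this
    · have h1 := ht.reg 0
      have h2 := hbdd'.1 0
      simp only [BinOp.eval, Nat.or_self]
      simp only [Nat.zero_add] at h1
      omega
  · have h1 : ((k + (1 + (k'' + 1)) : ℕ) : ℝ) ≤ ((k + 2 + 2 * k' : ℕ) : ℝ) := by
      exact_mod_cast (by omega)
    refine h1.trans ?_
    push_cast at hk ⊢
    have h2 : (k : ℝ) ≤ _ := Nat.cast_le.2 hk
    push_cast at h2
    linarith
  · rw [← hans]
    have h1 := ht.reg 0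
    simp only [Nat.zero_add] at h1
    simp [State.setReg, h1]

end WordRAM

open WordRAM Regexp

/-! ### The reduction from satisfiability -/

namespace CNFFormula

variable {n : ℕ}

theorem drop_encode (φ : CNFFormula n) :
    φ.encode.drop 2 = φ.codes.flatMap fun cl => cl.length :: cl := by
  simp [encode, codes, List.flatMap, Function.comp_def]

theorem length_codes (φ : CNFFormula n) : φ.codes.length = φ.length := by simp [codes]

theorem length_le_encode (φ : CNFFormula n) : φ.length + 2 ≤ φ.encode.length := by
  have h : ∀ l : List (List ℕ), l.length ≤ (l.flatMap fun cl => cl.length :: cl).length := by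
    intro l
    induction l with
    | nil => simp
    | cons a l ih => rw [List.flatMap_cons, List.length_append]; simp; omega
  have h1 := h φ.codes
  rw [← drop_encode, length_codes] at h1
  have h2 : 2 ≤ φ.encode.length := by simp [encode]
  rw [List.length_drop] at h1
  omega

/-- The word size has to accommodate the input; the factor 2 comes from the codes `2 i + b` of the
literals. -/
theorem encode_le (φ : CNFFormula n) : ∀ v ∈ φ.encode, v ≤ 2 * (2 ^ n + φ.encode.length) := by
  intro v hv
  have hn : n < 2 ^ n := Nat.lt_two_pow_self
  have hl := φ.length_le_encode
  rw [← List.take_append_drop 2 φ.encode, List.mem_append, drop_encode] at hv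
  rcases hv with hv | hv
  · have : v = n ∨ v = φ.length := by simpa [encode] using hv
    rcases this with rfl | rfl <;> omega
  · obtain ⟨cl, hcl, hv⟩ := List.mem_flatMap.1 hv
    rcases List.mem_cons.1 hv with rfl | hv
    · have h1 : (cl.length :: cl).length ≤ (φ.codes.flatMap fun cl => cl.length :: cl).length := by
        rw [List.length_flatMap]
        exact List.le_sum_of_mem (List.mem_map_of_mem hcl)
      rw [← drop_encode, List.length_drop, List.length_cons] at h1
      omega
    · obtain ⟨cl', _, rfl⟩ := List.mem_map.1 hcl
      obtain ⟨l, _, rfl⟩ := List.mem_map.1 hv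
      have := l.1.2
      have : l.2.toNat ≤ 1 := Bool.toNat_le _
      omega

end CNFFormula

/-- The expression of type `∘∗` for a formula with `n` variables. -/
def patternExpr {n : ℕ} (φ : CNFFormula n) : Regexp :=
  cat (pattern (patternVec ((n + 1) / 2) φ.codes) (2 ^ ((n + 1) / 2) + 1 + 1) ((φ.length + 2) * 2)
    (9 * 2 ^ ((n + 1) / 2) * ((φ.length + 2) * 2 + 1)))

/-- The word that belongs to `patternExpr φ` up to its last letter. -/
def textWord {n : ℕ} (φ : CNFFormula n) : List ℕ :=
  text (textVec ((n + 1) / 2) φ.codes) (9 * 2 ^ ((n + 1) / 2))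

section

variable {n : ℕ} (φ : CNFFormula n)

theorem textWord_mem_iff : textWord φ ++ [4] ∈ (patternExpr φ).lang ↔ φ.Satisfiable := by
  rw [satisfiable_iff_aligned (h := (n + 1) / 2) (by omega), patternExpr, textWord,
    text_mem_pattern_iff (D := φ.length + 2) (patternVec_le _ _) (textVec_le _ _) (by omega)
      (fun i => by rw [length_patternVec, φ.length_codes])
      (fun i => by rw [length_textVec, φ.length_codes]) (by omega) (le_of_eq (by ring))]

theorem exists_common_word_iff {t : List RegOp} {pre mid : List ℕ} {B : Regexp}
    (hB : IsWordExpr t pre mid (textWord φ) B) :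
    (∃ w, w ∈ (patternExpr φ).lang ∧ w ∈ B.lang) ↔ φ.Satisfiable := by
  rw [← textWord_mem_iff]
  constructor
  · rintro ⟨w, hA, hw⟩
    obtain ⟨u, rfl, hu⟩ := eq_of_mem_pattern (patternVec_le _ _) hA
    rwa [← hB.eq u hu hw]
  · exact fun h => ⟨_, h, hB.mem⟩

theorem textWord_le : ∀ v ∈ textWord φ, v ≤ 3 := fun _ hv =>
  le_three_of_mem_text (textVec_le _ _) hv

theorem length_textWord : (textWord φ).length =
    9 * 2 ^ ((n + 1) / 2) * ((φ.length + 2) * 2 + 1) := by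
  rw [textWord, length_text (D := φ.length + 2)
    (fun i => by rw [length_textVec, φ.length_codes])]
  ring

theorem isItem_patternExpr : ∀ e ∈ pattern (patternVec ((n + 1) / 2) φ.codes)
    (2 ^ ((n + 1) / 2) + 1 + 1) ((φ.length + 2) * 2)
    (9 * 2 ^ ((n + 1) / 2) * ((φ.length + 2) * 2 + 1)), IsItem 4 e :=
  fun _ he => isItem_of_mem_pattern (patternVec_le _ _) he

theorem isHomogeneous_patternExpr : (patternExpr φ).IsHomogeneous [RegOp.cat, RegOp.star] := by
  refine isHomogeneous_cat_items (isItem_patternExpr φ) (a := 0) ?_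
  rw [pattern, List.mem_append]
  exact Or.inl (mem_down.2 ⟨0, by positivity, by simp⟩)

theorem size_patternExpr : (patternExpr φ).size = (2 ^ ((n + 1) / 2) + 2) *
    (3 + 15 * (φ.length + 2)) + 8 * (9 * 2 ^ ((n + 1) / 2) * ((φ.length + 2) * 2 + 1)) + 1 := by
  rw [patternExpr, size_cat_items (isItem_patternExpr φ), length_pattern (D := φ.length + 2)
    (fun i => by rw [length_patternVec, φ.length_codes])]
  ring

theorem length_encode_cat_items {N : ℕ} {es : List Regexp} (h : ∀ e ∈ es, IsItem N e) :
    (cat es).encode.length ≤ 3 * es.length + 2 := by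
  rw [encode_cat, List.length_append]
  have : (encodes es).length ≤ 3 * es.length := by
    induction es with
    | nil => simp [encodes]
    | cons e es ih =>
      have := ih fun e he => h e (by simp [he])
      obtain ⟨a, _, rfl | rfl⟩ := h e (by simp)
      · rw [encodes_letter]; simp; omega
      · rw [encodes_star]; simp; omega
  simp
  omega

theorem length_encode_patternExpr :
    (patternExpr φ).encode.length ≤ 3 * (patternExpr φ).size + 2 := by
  rw [patternExpr, size_cat_items (isItem_patternExpr φ)]
  exact length_encode_cat_items (isItem_patternExpr φ)

end

/-! ### Size and time estimates -/

/-- The sizes that occur in the reduction: `M = 2 ^ ⌈n / 2⌉`, `N = 2 ^ n`, `D - 2` clauses, input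
length `L`. -/
theorem size_bounds {M D L : ℕ} (hM : 1 ≤ M) (hL : 2 ≤ L) (hD : D ≤ L) :
    9 * M * (D * 2 + 1) ≤ 27 * (M * L) ∧ (M + 2) * (3 + 15 * D) ≤ 51 * (M * L) ∧
    (M + 2) * (25 * L + 84 * D + 66) ≤ 426 * (M * L) ∧ 9 * M * (25 * L + 35) ≤ 387 * (M * L) ∧
    2 ≤ M * L ∧ M ≤ M * L ∧ L ≤ M * L := by
  refine ⟨?_, ?_, ?_, ?_, by nlinarith, by nlinarith, by nlinarith⟩
  · calc 9 * M * (D * 2 + 1) ≤ 9 * M * (3 * L) := Nat.mul_le_mul_left _ (by omega)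
      _ = 27 * (M * L) := by ring
  · calc (M + 2) * (3 + 15 * D) ≤ (3 * M) * (17 * L) := Nat.mul_le_mul (by omega) (by omega)
      _ = 51 * (M * L) := by ring
  · calc (M + 2) * (25 * L + 84 * D + 66) ≤ (3 * M) * (142 * L) :=
        Nat.mul_le_mul (by omega) (by omega)
      _ = 426 * (M * L) := by ring
  · calc 9 * M * (25 * L + 35) ≤ (9 * M) * (43 * L) := Nat.mul_le_mul_left _ (by omega)
      _ = 387 * (M * L) := by ring

theorem two_pow_half (n : ℕ) : 2 ^ ((n + 1) / 2) * 2 ^ ((n + 1) / 2) ≤ 2 * 2 ^ n := by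
  rw [← pow_add, ← pow_succ']
  exact Nat.pow_le_pow_right (by norm_num) (by omega)

theorem two_pow_half_le_rpow {n : ℕ} {ε : ℝ} (hε : ε ≤ 1 / 2) :
    ((2 ^ ((n + 1) / 2) : ℕ) : ℝ) ≤ 2 * (2 : ℝ) ^ ((1 - ε) * n) := by
  have h1 : (((n + 1) / 2 : ℕ) : ℝ) ≤ ((n : ℝ) + 1) / 2 := by
    have := Nat.cast_div_le (α := ℝ) (m := n + 1) (n := 2)
    push_cast at this
    exact this
  have hn : (0 : ℝ) ≤ n := Nat.cast_nonneg n
  calc ((2 ^ ((n + 1) / 2) : ℕ) : ℝ) = (2 : ℝ) ^ (((n + 1) / 2 : ℕ) : ℝ) := by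
        rw [Real.rpow_natCast]; norm_cast
    _ ≤ (2 : ℝ) ^ (1 + (1 - ε) * n) :=
        Real.rpow_le_rpow_of_exponent_le (by norm_num) (by nlinarith)
    _ = 2 * (2 : ℝ) ^ ((1 - ε) * n) := by rw [Real.rpow_add (by norm_num), Real.rpow_one]

/-- The exponent is first raised to `1 - ε ≥ 0`, which is legitimate as `y ≥ 1`; only then is
monotonicity in the base available, since `1 - α` may be negative. -/
theorem rpow_le_of_le_mul_two_pow {n : ℕ} {α ε y B : ℝ} (hα : ε ≤ α) (hε : 0 ≤ ε) (hε' : ε ≤ 1)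
    (hy : 1 ≤ y) (hB : 1 ≤ B) (hyB : y ≤ B * 2 ^ n) :
    y ^ (1 - α) ≤ B * (2 : ℝ) ^ ((1 - ε) * n) := by
  calc y ^ (1 - α) ≤ y ^ (1 - ε) := Real.rpow_le_rpow_of_exponent_le hy (by linarith)
    _ ≤ (B * 2 ^ n) ^ (1 - ε) := Real.rpow_le_rpow (by linarith) hyB (by linarith)
    _ = B ^ (1 - ε) * (2 : ℝ) ^ ((1 - ε) * n) := by
        rw [Real.mul_rpow (by linarith) (by positivity), ← Real.rpow_natCast, ← Real.rpow_mul
          (by norm_num), mul_comm (n : ℝ)]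
    _ ≤ B * (2 : ℝ) ^ ((1 - ε) * n) := by
        refine mul_le_mul_of_nonneg_right ?_ (by positivity)
        calc B ^ (1 - ε) ≤ B ^ (1 : ℝ) := Real.rpow_le_rpow_of_exponent_le hB (by linarith)
          _ = B := Real.rpow_one B

theorem time_bound {n M L m k T : ℕ} {α ε : ℝ} (C : ℕ) (hα : ε ≤ α) (hε : 0 ≤ ε)
    (hε' : ε ≤ 1 / 2) (hL : 1 ≤ L) (hM : (M : ℝ) ≤ 2 * (2 : ℝ) ^ ((1 - ε) * n))
    (hMM : M * M ≤ 2 * 2 ^ n) (hm : m ≤ 268 * (M * L)) (hk : k ≤ 28 * (M * L)) (hm1 : 1 ≤ m)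
    (hk1 : 1 ≤ k) (hT : T ≤ 2400 * (M * L)) :
    (T : ℝ) + 2 * (C * (((m : ℝ) * (k : ℝ)) ^ (1 - α) + (m : ℝ) + (k : ℝ))) ≤
      (4800 + 31200 * C : ℕ) * (2 : ℝ) ^ ((1 - ε) * n) * (L : ℝ) ^ (4800 + 31200 * C) := by
  set P := (2 : ℝ) ^ ((1 - ε) * n) with hP
  have hP0 : 0 < P := by positivity
  have hL' : (1 : ℝ) ≤ L := by exact_mod_cast hL
  have hC : (0 : ℝ) ≤ C := Nat.cast_nonneg C
  have hL2 : (L : ℝ) ≤ (L : ℝ) ^ 2 := by nlinarith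
  have hPL : P * L ≤ P * (L : ℝ) ^ 2 := mul_le_mul_of_nonneg_left hL2 hP0.le
  have hML : (M : ℝ) * L ≤ 2 * (P * (L : ℝ) ^ 2) := by nlinarith
  have hT' : (T : ℝ) ≤ 2400 * (M * L) := by exact_mod_cast hT
  have hm' : (m : ℝ) ≤ 268 * (M * L) := by exact_mod_cast hm
  have hk' : (k : ℝ) ≤ 28 * (M * L) := by exact_mod_cast hk
  have hmk : (m : ℝ) * k ≤ 15008 * (L : ℝ) ^ 2 * 2 ^ n := by
    have : m * k ≤ 15008 * L ^ 2 * 2 ^ n := by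
      calc m * k ≤ 268 * (M * L) * (28 * (M * L)) := Nat.mul_le_mul hm hk
        _ = 7504 * L ^ 2 * (M * M) := by ring
        _ ≤ 7504 * L ^ 2 * (2 * 2 ^ n) := Nat.mul_le_mul_left _ hMM
        _ = 15008 * L ^ 2 * 2 ^ n := by ring
    exact_mod_cast this
  have hpow := rpow_le_of_le_mul_two_pow hα hε (by linarith) (y := (m : ℝ) * k)
    (B := 15008 * (L : ℝ) ^ 2) (by exact_mod_cast Nat.mul_pos hm1 hk1) (by nlinarith) hmk
  rw [← hP] at hpow
  -- `15600 = 15008 + 2 * (268 + 28)`, the factor 2 coming from `M ≤ 2 P`.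
  have hsum : ((m : ℝ) * (k : ℝ)) ^ (1 - α) + (m : ℝ) + (k : ℝ) ≤ 15600 * (P * (L : ℝ) ^ 2) := by
    nlinarith
  calc (T : ℝ) + 2 * (C * (((m : ℝ) * (k : ℝ)) ^ (1 - α) + (m : ℝ) + (k : ℝ)))
      ≤ 4800 * (P * (L : ℝ) ^ 2) + 2 * (C * (15600 * (P * (L : ℝ) ^ 2))) := by
        have := mul_le_mul_of_nonneg_left hsum hC
        linarith
    _ = (4800 + 31200 * C : ℕ) * P * (L : ℝ) ^ 2 := by push_cast; ring
    _ ≤ _ := by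
        refine mul_le_mul_of_nonneg_left (pow_le_pow_right₀ hL' (by omega)) (by positivity)

set_option maxHeartbeats 1000000 in
theorem kSatSolvable_of_intersectionTestingSolvable {t : List RegOp}
    (ht : t ∈ [[RegOp.cat, RegOp.star], [RegOp.cat, RegOp.alt], [RegOp.cat, RegOp.plus],
      [RegOp.alt, RegOp.cat], [RegOp.plus, RegOp.cat], [RegOp.star, RegOp.cat]])
    {a : ℕ} (ha : 1 ≤ a) {α ε : ℝ} (hα : ε ≤ α) (hε : 0 ≤ ε) (hε' : ε ≤ 1 / 2)
    (H : IntersectionTestingSolvable [RegOp.cat, RegOp.star] t a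
      (fun m n => ((m : ℝ) * (n : ℝ)) ^ (1 - α) + (m : ℝ) + (n : ℝ))) (k : ℕ) :
    KSatSolvable k (1 - ε) := by
  obtain ⟨p, c, C, hp⟩ := H
  obtain ⟨pre, mid, hle, hpm, hB⟩ := exists_isWordExpr ht
  -- With `X = 2 ^ n + L`, the total size of the expressions is at most `X ^ 8`, so the words of `p`
  -- are bounded by `X ^ (8 c)`; the factor `X ^ 9` leaves room for the input offset and the written
  -- output.
  refine ⟨reduction pre mid p, 8 * c + 9, 4800 + 31200 * C, fun n φ _ => ?_⟩
  obtain ⟨B, hB⟩ := hB (textWord φ) fun h4 => absurd (textWord_le φ 4 h4) (by norm_num)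
  have hA := size_patternExpr φ
  have hBs := hB.size
  rw [length_textWord] at hBs
  have hencA := length_encode_patternExpr φ
  have hencB := congrArg List.length hB.encode
  have hwritten : written pre mid ((n + 1) / 2) φ.length φ.codes =
      (patternExpr φ).encode ++ B.encode := by
    rw [hB.encode, length_textWord]
    rfl
  have hlm : (textWord φ).length = 9 * 2 ^ ((n + 1) / 2) * ((φ.length + 2) * 2 + 1) :=
    length_textWord φ
  simp only [List.length_append, List.length_cons, List.length_nil, List.length_flatMap] at hencB
  simp only [List.map_const', List.sum_replicate, smul_eq_mul, hlm] at hencB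
  have hL := φ.length_le_encode
  have hM1 : 1 ≤ 2 ^ ((n + 1) / 2) := Nat.one_le_two_pow
  obtain ⟨b1, b2, b3, b4, b5, b6, b7⟩ := size_bounds hM1 (by omega : 2 ≤ φ.encode.length) hL
  have hMM := two_pow_half n
  have hN : n < 2 ^ n := Nat.lt_two_pow_self
  have hvals := φ.encode_le
  have hMR := two_pow_half_le_rpow (n := n) hε'
  have hdec := hp (patternExpr φ) B (isHomogeneous_patternExpr φ) hB.homogeneous (fun v hv => by
    have hv4 : v ≤ 4 := by
      rcases List.mem_append.1 hv with hv | hv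
      · exact letters_cat_items (isItem_patternExpr φ) v hv
      · rw [hB.letters, List.mem_append] at hv
        rcases hv with hv | hv
        · exact (textWord_le φ v hv).trans (by norm_num)
        · simp at hv; omega
    -- The letters are at most 4, which is below the total size and hence below its `a`-th power, as
    -- `a ≥ 1`.
    refine lt_of_lt_of_le ?_ (Nat.le_self_pow (by omega) _)
    have : 1 ≤ 9 * 2 ^ ((n + 1) / 2) * ((φ.length + 2) * 2 + 1) := by
      exact Nat.mul_pos (by omega) (by omega)
    omega)
  rw [exists_common_word_iff φ hB, ← hwritten] at hdec
  have hwl := congrArg List.length hwritten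
  rw [List.length_append] at hwl
  set L := φ.encode.length with hLdef
  set h := (n + 1) / 2 with hh
  set M := 2 ^ h with hMdef
  set K := 9 * M * ((φ.length + 2) * 2 + 1) with hK
  set X := 2 ^ n + L with hX
  have hX3 : 3 ≤ X := by omega
  have hMX : M ≤ 2 * X := (Nat.le_mul_self M).trans (by omega)
  have hMLX : M * L ≤ 2 * X ^ 2 := by
    calc M * L ≤ (2 * X) * X := Nat.mul_le_mul hMX (by omega)
      _ = 2 * X ^ 2 := by ring
  have hXX : 3 * X ≤ X ^ 2 := by rw [sq]; exact Nat.mul_le_mul_right X hX3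
  have hX9 : 2187 * X ^ 2 ≤ X ^ 9 := by
    calc 2187 * X ^ 2 = 3 ^ 7 * X ^ 2 := by norm_num
      _ ≤ X ^ 7 * X ^ 2 := Nat.mul_le_mul_right _ (Nat.pow_le_pow_left hX3 7)
      _ = X ^ 9 := by ring
  have hXc : X ^ 9 ≤ X ^ (8 * c + 9) := Nat.pow_le_pow_right (by omega) (by omega)
  have hVX : ((patternExpr φ).size + B.size) ^ c + L ≤ X ^ (8 * c + 9) := by
    have h8 : (patternExpr φ).size + B.size ≤ X ^ 8 := by
      calc (patternExpr φ).size + B.size ≤ 296 * (M * L) := by omega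
        _ ≤ 592 * X ^ 2 := by omega
        _ ≤ 3 ^ 6 * X ^ 2 := Nat.mul_le_mul_right _ (by norm_num)
        _ ≤ X ^ 6 * X ^ 2 := Nat.mul_le_mul_right _ (Nat.pow_le_pow_left hX3 6)
        _ = X ^ 8 := by ring
    have h1 : 1 ≤ X ^ (8 * c) := Nat.one_le_pow _ _ (by omega)
    calc ((patternExpr φ).size + B.size) ^ c + L ≤ (X ^ 8) ^ c + L := by
          have := Nat.pow_le_pow_left h8 c
          omega
      _ = X ^ (8 * c) * 1 + L := by rw [pow_mul, mul_one]
      _ ≤ X ^ (8 * c) * 1 + X ^ (8 * c) * L := Nat.add_le_add_left (Nat.le_mul_of_pos_left L h1) _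
      _ = X ^ (8 * c) * (1 + L) := by ring
      _ ≤ X ^ (8 * c) * X ^ 9 := Nat.mul_le_mul_left _ (by omega)
      _ = X ^ (8 * c + 9) := by ring
  have hred := decides_reduction (W := X ^ (8 * c + 9)) (x := φ.encode) (n := n) (d := φ.length)
    (h := h) (pre := pre) (mid := mid) (cls := φ.codes) (by omega)
    (fun v hv => by have := hvals v hv; omega) rfl rfl φ.length_codes.symm φ.drop_encode rfl
    (fun v hv => by
      simp only [globals, List.mem_cons, List.not_mem_nil, or_false, ← hMdef, ← hK,
        ← hLdef] at hv
      have hD : 15 * (φ.length + 2) ≤ 15 * L := by omega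
      rcases hv with rfl | rfl | rfl | rfl | rfl | rfl | rfl | rfl | rfl | rfl | rfl | rfl | rfl |
        rfl | rfl | rfl | rfl | rfl | rfl | rfl | rfl | rfl | rfl | rfl | rfl | rfl | rfl | rfl <;>
        omega)
    (by rw [← hMdef, mul_assoc]; omega) hle (by omega) hVX hdec
  obtain ⟨r1, r2, j, s, r3, r4, r5⟩ := hred
  refine ⟨r1, r2, j, s, r3, r4.trans ?_, r5⟩
  exact time_bound C hα hε hε' (by omega) hMR hMM (by omega) (by omega) (by omega) (by omega)
    (by rw [← hMdef, ← hLdef, ← hK]; omega)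

theorem mainTheorem8 (hSETH : SETH) (t : List RegOp)
    (ht : t ∈ [[RegOp.cat, RegOp.star], [RegOp.cat, RegOp.alt], [RegOp.cat, RegOp.plus],
      [RegOp.alt, RegOp.cat], [RegOp.plus, RegOp.cat], [RegOp.star, RegOp.cat]])
    (a : ℕ) (ha : 1 ≤ a) (α : ℝ) (hα : 0 < α) :
    ¬ IntersectionTestingSolvable [RegOp.cat, RegOp.star] t a
      (fun m n => ((m : ℝ) * (n : ℝ)) ^ (1 - α) + (m : ℝ) + (n : ℝ)) := by
  intro H
  -- The cap `1 / 2` covers the time for writing the expressions and the linear terms, both of order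
  -- `2 ^ (n / 2)` up to a polynomial in `L`.
  have hε : 0 < min α (1 / 2) := lt_min hα (by norm_num)
  obtain ⟨k, hk⟩ := hSETH _ hε
  exact hk (kSatSolvable_of_intersectionTestingSolvable ht ha (min_le_left _ _) hε.le
    (min_le_right _ _) H k)
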